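/- Let $C=\mathbb{R}+e\mathbb{R}$, $e^2=1$, be the algebra of para-complex numbers, with conjugation $\overline{x+ey}=x-ey$. Let $M$ be a connected smooth manifold of real dimension $2n$, $n\ge 3$, with a para-complex structure $I$: a smooth field of endomorphisms of $TM$ with $I^2=\mathrm{Id}$, $I\ne\pm\mathrm{Id}$, whose eigenspaces for $+1$ and $-1$ have equal dimension at each point and form integrable distributions. Write $T_CM=TM\otimes_{\mathbb R}C$, extend $I$ $C$-linearly, and let $T^{1,0}M$, $T^{0,1}M$ be the subbundles of $T_CM$ on which $I=e$, $I=-e$ respectively. A para-holomorphic chart is a smooth chart $(z^a)$ with values in $C^n$ and $dz^a\circ I=e\,dz^a$; for $z^a=x^a+ey^a$ put $\partial_a=\frac{\partial}{\partial z^a}=\frac12\big(\frac{\partial}{\partial x^a}+e\frac{\partial}{\partial y^a}\big)$ and $\frac{\partial}{\partial \bar z^{a}}=\frac12\big(\frac{\partial}{\partial x^a}-e\frac{\partial}{\partial y^a}\big)$. Let $G$ be a para-holomorphic Riemannian metric on $(M,I)$: a smooth field of symmetric nondegenerate $C$-bilinear forms on $T_CM$ with $G(\overline{Z},\overline{W})=\overline{G(Z,W)}$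 and $G(T^{1,0}M,T^{0,1}M)=0$, such that $G_{ab}=G(\partial_a,\partial_b)$ satisfies $\partial G_{ab}/\partial\bar z^{c}=0$ for all $a,b,c$ in every para-holomorphic chart. Let $L^c_{ab}=\frac12 G^{cd}(\partial_aG_{bd}+\partial_bG_{ad}-\partial_dG_{ab})$, where $(G^{cd})$ is the inverse matrix of $(G_{cd})$, and let $$R^d_{c,ab}=\partial_aL^d_{cb}-\partial_bL^d_{ca}+L^f_{cb}L^d_{fa}-L^f_{ca}L^d_{fb},\qquad \mathcal R(Z_1,Z_2,Z_3,Z_4)=G_{df}R^f_{c,ab}Z_1^aZ_2^bZ_3^cZ_4^d$$ be the curvature tensor on $T^{1,0}M$, where $Z_i=Z_i^a\partial_a$. For a nondegenerate $2$-plane $P=\mathrm{span}_C\{Z_1,Z_2\}\subset T^{1,0}_pM$ (i.e. $G(Z_1,Z_1)G(Z_2,Z_2)-G(Z_1,Z_2)^2$ is invertible in $C$) the para-holomorphic sectional curvature is $$K_p(P)=\frac{\mathcal R(Z_1,Z_2,Z_1,Z_2)}{G(Z_1,Z_1)G(Z_2,Z_2)-G(Z_1,Z_2)^2}\in C.$$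 Theorem. If for each $p\in M$ the value $K_p(P)$ is the same for all nondegenerate $2$-planes $P\subset T^{1,0}_pM$, then there is a constant $c\in C$ with $K_p(P)=c$ for all $p\in M$ and all nondegenerate $2$-planes $P\subset T^{1,0}_pM$. -/

import Mathlib

open scoped Manifold ContDiff TensorProduct

noncomputable section

/-- The algebra `C = ℝ + eℝ`, `e² = 1`, of para-complex numbers. -/
abbrev ParaComplex : Type := QuadraticAlgebra ℝ 1 0

namespace ParaComplex

/-- The para-complex unit `e = (0, 1)`. -/
def e : ParaComplex := ⟨0, 1⟩

/-- The real-linear identification of `C` with `ℝ × ℝ`. -/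
def toProd : ParaComplex →ₗ[ℝ] ℝ × ℝ :=
  LinearMap.prod (QuadraticAlgebra.reₗ 1 0) (QuadraticAlgebra.imₗ 1 0)

theorem toProd_injective : Function.Injective toProd := by
  intro z w h
  have h1 : z.re = w.re := congrArg Prod.fst h
  have h2 : z.im = w.im := congrArg Prod.snd h
  exact QuadraticAlgebra.ext h1 h2

/-- `C` carries the norm of `ℝ × ℝ` (only its topology and real smooth structure matter). -/
instance : NormedAddCommGroup ParaComplex :=
  NormedAddCommGroup.induced ParaComplex (ℝ × ℝ) toProd toProd_injective

instance : NormedSpace ℝ ParaComplex :=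
  NormedSpace.induced ℝ ParaComplex (ℝ × ℝ) toProd

/-- Conjugation `x + ey ↦ x - ey` as a real-linear map. -/
def conj : ParaComplex →ₗ[ℝ] ParaComplex where
  toFun z := ⟨z.re, -z.im⟩
  map_add' z w := by ext <;> simp [add_comm]
  map_smul' r z := by ext <;> simp

end ParaComplex

/-- The space `Cⁿ`, regarded as a real normed space of dimension `2n`. -/
abbrev ParaSpace (n : ℕ) : Type := Fin n → ParaComplex

section Manifold

variable (n : ℕ) (M : Type*) [TopologicalSpace M] [ChartedSpace (ParaSpace n) M]

variable {n M} in
/-- The differential of a chart `φ : U → Cⁿ` at `p`. -/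
def chartDeriv (φ : OpenPartialHomeomorph M (ParaSpace n)) (p : M) :
    TangentSpace 𝓘(ℝ, ParaSpace n) p →L[ℝ] ParaSpace n :=
  mfderiv 𝓘(ℝ, ParaSpace n) 𝓘(ℝ, ParaSpace n) φ p

/-- A distribution (field of subspaces of the tangent spaces of the real manifold `M`) is
integrable if around every point there is a smooth chart that straightens it, that is, in which
it is a constant field of subspaces. -/
def IsIntegrableDistribution
    (D : ∀ p : M, Submodule ℝ (TangentSpace 𝓘(ℝ, ParaSpace n) p)) : Prop :=
  ∀ p : M, ∃ φ ∈ IsManifold.maximalAtlas 𝓘(ℝ, ParaSpace n) ∞ M, p ∈ φ.source ∧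
    ∃ F : Submodule ℝ (ParaSpace n), ∀ q ∈ φ.source, ∀ v : TangentSpace 𝓘(ℝ, ParaSpace n) q,
      v ∈ D q ↔ chartDeriv φ q v ∈ F

/-- A para-complex structure on a smooth manifold `M` of real dimension `2n`: a smooth field `I` of
endomorphisms of `TM` with `I² = Id`, `I ≠ ± Id`, whose eigenspaces for the eigenvalues `1` and
`-1` have equal dimension and form integrable distributions. -/
structure ParaComplexStructure [IsManifold 𝓘(ℝ, ParaSpace n) ∞ M] where
  /-- The endomorphism field. -/
  I : ∀ p : M, TangentSpace 𝓘(ℝ, ParaSpace n) p →L[ℝ] TangentSpace 𝓘(ℝ, ParaSpace n) p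
  smooth : ContMDiff 𝓘(ℝ, ParaSpace n)
    (𝓘(ℝ, ParaSpace n).prod 𝓘(ℝ, ParaSpace n →L[ℝ] ParaSpace n)) ∞
    (fun p => Bundle.TotalSpace.mk' (ParaSpace n →L[ℝ] ParaSpace n)
      (E := fun p : M => TangentSpace 𝓘(ℝ, ParaSpace n) p →L[ℝ]
        TangentSpace 𝓘(ℝ, ParaSpace n) p) p (I p))
  sq : ∀ p v, I p (I p v) = v
  ne_id : ∀ p, I p ≠ ContinuousLinearMap.id ℝ _
  ne_neg_id : ∀ p, I p ≠ -ContinuousLinearMap.id ℝ _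
  finrank_eq : ∀ p, Module.finrank ℝ (Module.End.eigenspace (I p).toLinearMap (1 : ℝ)) =
    Module.finrank ℝ (Module.End.eigenspace (I p).toLinearMap (-1 : ℝ))
  integrable_pos :
    IsIntegrableDistribution n M fun p => Module.End.eigenspace (I p).toLinearMap (1 : ℝ)
  integrable_neg :
    IsIntegrableDistribution n M fun p => Module.End.eigenspace (I p).toLinearMap (-1 : ℝ)

/-- The para-complexified tangent space `T_p M ⊗ C`. -/
abbrev ParaTangent (p : M) : Type :=
  ParaComplex ⊗[ℝ] TangentSpace 𝓘(ℝ, ParaSpace n) p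

variable {n M}

/-- Conjugation on the para-complexified tangent space. -/
def ParaTangent.conj (p : M) : ParaTangent n M p →ₗ[ℝ] ParaTangent n M p :=
  TensorProduct.map ParaComplex.conj LinearMap.id

/-- The real tangent vector `v`, viewed in the para-complexified tangent space. -/
def ParaTangent.ofReal {p : M} (v : TangentSpace 𝓘(ℝ, ParaSpace n) p) : ParaTangent n M p :=
  (1 : ParaComplex) ⊗ₜ[ℝ] v

namespace ParaComplexStructure

variable [IsManifold 𝓘(ℝ, ParaSpace n) ∞ M] (J : ParaComplexStructure n M)

/-- The `C`-linear extension of `I` to the para-complexified tangent space. -/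
def extend (p : M) : ParaTangent n M p →ₗ[ParaComplex] ParaTangent n M p :=
  (J.I p).toLinearMap.baseChange ParaComplex

/-- `T^{1,0}_p M = {Z | I Z = e Z}`. -/
def T10 (p : M) : Submodule ParaComplex (ParaTangent n M p) :=
  Module.End.eigenspace (J.extend p) ParaComplex.e

/-- `T^{0,1}_p M = {Z | I Z = -e Z}`. -/
def T01 (p : M) : Submodule ParaComplex (ParaTangent n M p) :=
  Module.End.eigenspace (J.extend p) (-ParaComplex.e)

/-- A para-holomorphic chart: a smooth chart `φ : U → Cⁿ` with `dφ ∘ I = e dφ`, that is, whose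
components `zᵃ = xᵃ + e yᵃ` are para-holomorphic functions. -/
structure IsParaHolomorphicChart (φ : OpenPartialHomeomorph M (ParaSpace n)) : Prop where
  mem_maximalAtlas : φ ∈ IsManifold.maximalAtlas 𝓘(ℝ, ParaSpace n) ∞ M
  chartDeriv_I : ∀ p ∈ φ.source, ∀ v : TangentSpace 𝓘(ℝ, ParaSpace n) p,
    chartDeriv φ p (J.I p v) = ParaComplex.e • chartDeriv φ p v

end ParaComplexStructure

/-- The coordinate vector field of the chart `φ` in the direction `w ∈ Cⁿ = ℝ²ⁿ`, at the point with
coordinates `u`. For `w = e_a` it is `∂/∂xᵃ`, and for `w = e • e_a` it is `∂/∂yᵃ`. -/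
def coordVector (φ : OpenPartialHomeomorph M (ParaSpace n)) (w u : ParaSpace n) :
    TangentSpace 𝓘(ℝ, ParaSpace n) (φ.symm u) :=
  mfderiv 𝓘(ℝ, ParaSpace n) 𝓘(ℝ, ParaSpace n) φ.symm u w

/-- `∂/∂zᵃ = (1/2)(∂/∂xᵃ + e ∂/∂yᵃ)` at the point with coordinates `u`. -/
def coordZ (φ : OpenPartialHomeomorph M (ParaSpace n)) (a : Fin n) (u : ParaSpace n) :
    ParaTangent n M (φ.symm u) :=
  (2⁻¹ : ℝ) • (ParaTangent.ofReal (coordVector φ (Pi.single a 1) u) +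
    ParaComplex.e • ParaTangent.ofReal (coordVector φ (Pi.single a ParaComplex.e) u))

/-- `dz(Z) = (dz¹(Z), …, dzⁿ(Z))`: the `C`-linear extension of `dφ` to `T_p M ⊗ C`. For `Z` in
`T^{1,0}` of a para-holomorphic chart these are the components in `Z = ∑ Zᵃ ∂/∂zᵃ`. -/
def dz (φ : OpenPartialHomeomorph M (ParaSpace n)) (p : M) :
    ParaTangent n M p →ₗ[ParaComplex] ParaSpace n :=
  LinearMap.liftBaseChange ParaComplex (chartDeriv φ p).toLinearMap

/-- `∂f/∂zᵃ = (1/2)(∂f/∂xᵃ + e ∂f/∂yᵃ)` for a `C`-valued function on `Cⁿ`. -/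
def partialZ (a : Fin n) (f : ParaSpace n → ParaComplex) (u : ParaSpace n) : ParaComplex :=
  (2⁻¹ : ℝ) • (fderiv ℝ f u (Pi.single a 1) +
    ParaComplex.e * fderiv ℝ f u (Pi.single a ParaComplex.e))

/-- `∂f/∂z̄ᵃ = (1/2)(∂f/∂xᵃ - e ∂f/∂yᵃ)` for a `C`-valued function on `Cⁿ`. -/
def partialZBar (a : Fin n) (f : ParaSpace n → ParaComplex) (u : ParaSpace n) : ParaComplex :=
  (2⁻¹ : ℝ) • (fderiv ℝ f u (Pi.single a 1) -
    ParaComplex.e * fderiv ℝ f u (Pi.single a ParaComplex.e))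

/-- A para-complex Riemannian metric on `(M, I)`: a smooth field of symmetric nondegenerate
`C`-bilinear forms on the spaces `T_p M ⊗ C` that is compatible with conjugation and for which
`T^{1,0}` and `T^{0,1}` are orthogonal. -/
structure ParaComplexMetric [IsManifold 𝓘(ℝ, ParaSpace n) ∞ M]
    (J : ParaComplexStructure n M) where
  /-- The field of bilinear forms. -/
  G : ∀ p : M, LinearMap.BilinForm ParaComplex (ParaTangent n M p)
  smooth : ∀ (X Y : ∀ p : M, TangentSpace 𝓘(ℝ, ParaSpace n) p) (p : M),
    ContMDiffAt 𝓘(ℝ, ParaSpace n) 𝓘(ℝ, ParaSpace n).tangent ∞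
      (fun q => (⟨q, X q⟩ : TangentBundle 𝓘(ℝ, ParaSpace n) M)) p →
    ContMDiffAt 𝓘(ℝ, ParaSpace n) 𝓘(ℝ, ParaSpace n).tangent ∞
      (fun q => (⟨q, Y q⟩ : TangentBundle 𝓘(ℝ, ParaSpace n) M)) p →
    ContMDiffAt 𝓘(ℝ, ParaSpace n) 𝓘(ℝ, ParaComplex) ∞
      (fun q => G q (ParaTangent.ofReal (X q)) (ParaTangent.ofReal (Y q))) p
  symm : ∀ p Z W, G p Z W = G p W Z
  nondegenerate : ∀ p, (G p).Nondegenerate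
  conj : ∀ p Z W,
    G p (ParaTangent.conj p Z) (ParaTangent.conj p W) = ParaComplex.conj (G p Z W)
  orthogonal : ∀ p, ∀ Z ∈ J.T10 p, ∀ W ∈ J.T01 p, G p Z W = 0

namespace ParaComplexMetric

variable [IsManifold 𝓘(ℝ, ParaSpace n) ∞ M] {J : ParaComplexStructure n M}
  (g : ParaComplexMetric J)

/-- The matrix of local components `G_ab = G(∂/∂zᵃ, ∂/∂zᵇ)` in the chart `φ`, as a function of the
coordinates. -/
def comp (φ : OpenPartialHomeomorph M (ParaSpace n)) (u : ParaSpace n) :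
    Matrix (Fin n) (Fin n) ParaComplex :=
  Matrix.of fun a b => g.G (φ.symm u) (coordZ φ a u) (coordZ φ b u)

/-- `G` is a para-holomorphic Riemannian metric: its local components `G_ab` in para-holomorphic
charts are para-holomorphic functions, `∂G_ab/∂z̄ᶜ = 0`. -/
def IsParaHolomorphic : Prop :=
  ∀ φ : OpenPartialHomeomorph M (ParaSpace n), J.IsParaHolomorphicChart φ →
    ∀ u ∈ φ.target, ∀ a b c : Fin n, partialZBar c (fun v => g.comp φ v a b) u = 0

/-- The coefficients of the characteristic connection on `T^{1,0}`,
`Lᶜ_ab = (1/2) Gᶜᵈ (∂G_bd/∂zᵃ + ∂G_ad/∂zᵇ - ∂G_ab/∂zᵈ)`, where `(Gᶜᵈ)` is the inverse matrix. -/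
def christoffel (φ : OpenPartialHomeomorph M (ParaSpace n)) (c a b : Fin n) (u : ParaSpace n) :
    ParaComplex :=
  (2⁻¹ : ℝ) • ∑ d, (g.comp φ u)⁻¹ c d *
    (partialZ a (fun v => g.comp φ v b d) u + partialZ b (fun v => g.comp φ v a d) u -
      partialZ d (fun v => g.comp φ v a b) u)

/-- The curvature components
`Rᵈ_{c,ab} = ∂Lᵈ_cb/∂zᵃ - ∂Lᵈ_ca/∂zᵇ + Lᶠ_cb Lᵈ_fa - Lᶠ_ca Lᵈ_fb`. -/
def curvatureComp (φ : OpenPartialHomeomorph M (ParaSpace n)) (d c a b : Fin n)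
    (u : ParaSpace n) : ParaComplex :=
  partialZ a (g.christoffel φ d c b) u - partialZ b (g.christoffel φ d c a) u +
    ∑ f, (g.christoffel φ f c b u * g.christoffel φ d f a u -
      g.christoffel φ f c a u * g.christoffel φ d f b u)

/-- The Riemann curvature tensor `𝓡(Z₁, Z₂, Z₃, Z₄) = G(R(Z₁, Z₂) Z₃, Z₄)` on `T^{1,0}_p`, computed
in the para-holomorphic chart `φ` through its components `R_abcd = G_df Rᶠ_{c,ab}`. -/
def curvatureIn (φ : OpenPartialHomeomorph M (ParaSpace n)) (p : M)
    (Z₁ Z₂ Z₃ Z₄ : ParaTangent n M p) : ParaComplex :=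
  ∑ a, ∑ b, ∑ c, ∑ d,
    (∑ f, g.comp φ (φ p) d f * g.curvatureComp φ f c a b (φ p)) *
      dz φ p Z₁ a * dz φ p Z₂ b * dz φ p Z₃ c * dz φ p Z₄ d

open Classical in
/-- The Riemann curvature tensor at `p` on `T^{1,0}_p`, computed in a para-holomorphic chart around
`p` (being a tensor, it does not depend on which chart is used, and such charts exist because
the para-complex structure is integrable). -/
def curvature (p : M) (Z₁ Z₂ Z₃ Z₄ : ParaTangent n M p) : ParaComplex :=
  if h : ∃ φ : OpenPartialHomeomorph M (ParaSpace n), J.IsParaHolomorphicChart φ ∧ p ∈ φ.source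
  then g.curvatureIn h.choose p Z₁ Z₂ Z₃ Z₄
  else 0

/-- The denominator `G(Z₁, Z₁) G(Z₂, Z₂) - G(Z₁, Z₂)²` of the sectional curvature. -/
def gram (p : M) (Z₁ Z₂ : ParaTangent n M p) : ParaComplex :=
  g.G p Z₁ Z₁ * g.G p Z₂ Z₂ - g.G p Z₁ Z₂ ^ 2

/-- The pair `Z₁, Z₂` spans a para-holomorphic plane, that is, a nondegenerate `2`-plane in
`T^{1,0}_p`: the Gram determinant is invertible in `C`. -/
structure SpansParaHolomorphicPlane (p : M) (Z₁ Z₂ : ParaTangent n M p) : Prop where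
  left_mem : Z₁ ∈ J.T10 p
  right_mem : Z₂ ∈ J.T10 p
  isUnit_gram : IsUnit (g.gram p Z₁ Z₂)

/-- The para-holomorphic sectional curvature `K_p(P)` of the plane `P = span{Z₁, Z₂}`. -/
def sectionalCurvature (p : M) (Z₁ Z₂ : ParaTangent n M p) : ParaComplex :=
  g.curvature p Z₁ Z₂ Z₁ Z₂ * Ring.inverse (g.gram p Z₁ Z₂)

end ParaComplexMetric

end Manifold

end

/-! This is Schur's lemma. The classical argument survives because in a para-holomorphic chart the
components G_ab, and everything built from them by ∂_a and algebra, are para-holomorphic. Such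
functions form a commutative real algebra (`HolAlgebra`) on which the ∂_a are commuting derivations.
The Levi-Civita connection, the Bianchi identities and the tensor law of the curvature are therefore
formal identities over an algebra with derivations; evaluation at points links them to the
components in the statement.

At a single point, R is compared with T_abcd = G_ac G_bd - G_bc G_ad. Over ℝ, agreement of R and kT
on a Zariski-dense set of planes forces R = kT by polarization. The ring C has zero divisors, but x
+ ey ↦ (x + y, x - y) identifies it with ℝ × ℝ, and a nondegenerate pair of vectors in one factor
can be completed by a fixed nondegenerate pair in the other (`ParaComplex.eq_unitCurvature`).

Contracting R = kT with the inverse metric exhibits k as a para-holomorphic function. Since T is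
parallel, the second Bianchi identity says that the cyclic sum of (∂_e k) T_ab vanishes. For n ≥ 3
there are three distinct indices, and invertibility of G yields ∂_e k = 0 (`FormalGeometry.schur`).
As dk is C-linear, all its real derivatives vanish, so k is locally constant, hence constant on the
connected M.

Two facts about the setting are also needed. The curvature is defined through an arbitrarily chosen
chart, so it must not depend on the chart (`curvatureIn_eq`, from uniqueness of the Levi-Civita
connection). And para-holomorphic charts must exist (`exists_isParaHolomorphicChart`): n real
functions constant along the leaves of each eigendistribution are combined with the zero divisors 1
± e, and the inverse function theorem applies. -/

noncomputable section

open scoped Matrix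
open Topology ParaComplex

/-! ### Formal Riemannian geometry over a commutative algebra with derivations -/

section FormalGeometry

variable {A : Type*} [CommRing A] [Algebra ℝ A] {n : ℕ}

/-- A derivation acts on a product of matrices by the Leibniz rule. -/
theorem Derivation.matrix_map_mul (d : Derivation ℝ A A) (P Q : Matrix (Fin n) (Fin n) A) :
    (P * Q).map d = P.map d * Q + P * Q.map d := by
  ext i j
  simp only [Matrix.map_apply, Matrix.mul_apply, Matrix.add_apply, map_sum, Derivation.leibniz,
    smul_eq_mul, ← Finset.sum_add_distrib]
  refine Finset.sum_congr rfl fun k _ => ?_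
  ring

theorem Derivation.matrix_map_add (d : Derivation ℝ A A) (P Q : Matrix (Fin n) (Fin n) A) :
    (P + Q).map d = P.map d + Q.map d := by
  ext i j; simp

theorem Derivation.matrix_map_sub (d : Derivation ℝ A A) (P Q : Matrix (Fin n) (Fin n) A) :
    (P - Q).map d = P.map d - Q.map d := by
  ext i j; simp

namespace FormalGeometry

/-- The curvature matrices `R_ab = ∂_a Γ_b - ∂_b Γ_a + [Γ_a, Γ_b]` of the connection matrices `Γ`,
with respect to the derivations `D`. -/
def curv (D : Fin n → Derivation ℝ A A) (Γ : Fin n → Matrix (Fin n) (Fin n) A) (a b : Fin n) :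
    Matrix (Fin n) (Fin n) A :=
  (Γ b).map (D a) - (Γ a).map (D b) + (Γ a * Γ b - Γ b * Γ a)

/-- The Christoffel symbols of the metric matrix `G`. -/
def christoffel (D : Fin n → Derivation ℝ A A) (G : Matrix (Fin n) (Fin n) A) (c a b : Fin n) : A :=
  (2⁻¹ : ℝ) • ∑ d, G⁻¹ c d * (D a (G b d) + D b (G a d) - D d (G a b))

/-- The connection matrices `(Γ_a)ᵈ_c = Lᵈ_ca` of the metric matrix `G`. -/
def conn (D : Fin n → Derivation ℝ A A) (G : Matrix (Fin n) (Fin n) A) (a : Fin n) :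
    Matrix (Fin n) (Fin n) A :=
  Matrix.of fun d c => christoffel D G d c a

theorem two_smul_cancel {x y : A} (h : (2 : A) * x = 2 * y) : x = y := by
  have : (2⁻¹ : ℝ) • ((2 : A) * x) = (2⁻¹ : ℝ) • ((2 : A) * y) := by rw [h]
  have h2 : (2 : A) = algebraMap ℝ A 2 := (map_ofNat _ 2).symm
  rw [h2, ← Algebra.smul_def, ← Algebra.smul_def, smul_smul, smul_smul] at this
  simpa using this

variable {D : Fin n → Derivation ℝ A A} {G : Matrix (Fin n) (Fin n) A}

theorem matrix_map_comm (hD : ∀ a b x, D a (D b x) = D b (D a x)) (a b : Fin n)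
    (P : Matrix (Fin n) (Fin n) A) : (P.map (D a)).map (D b) = (P.map (D b)).map (D a) := by
  ext i j
  simp [hD a b]

theorem christoffel_symm (hG : G.IsSymm) (c a b : Fin n) :
    christoffel D G c a b = christoffel D G c b a := by
  unfold christoffel
  congr 1
  refine Finset.sum_congr rfl fun d _ => ?_
  rw [hG.apply b a]
  ring

/-- The Koszul formula: lowering the index cancels the inverse metric, and doubling clears the
factor 1/2. -/
theorem mul_conn_apply (hdet : IsUnit G.det) (a e c : Fin n) :
    2 * (G * conn D G a) e c = D c (G a e) + D a (G c e) - D e (G c a) := by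
  set w : Fin n → A := fun d => D c (G a d) + D a (G c d) - D d (G c a) with hw
  have h1 : (2 : A) * (G * conn D G a) e c = (G.mulVec (G⁻¹.mulVec w)) e := by
    rw [Matrix.mul_apply, Finset.mul_sum, Matrix.mulVec, dotProduct]
    refine Finset.sum_congr rfl fun d _ => ?_
    simp only [conn, christoffel, Matrix.of_apply, Matrix.mulVec, dotProduct, hw]
    have h2 : (2 : A) = algebraMap ℝ A 2 := (map_ofNat _ 2).symm
    rw [mul_smul_comm, h2, ← Algebra.smul_def, smul_smul]
    simp
  rw [h1, Matrix.mulVec_mulVec, Matrix.mul_nonsing_inv _ hdet, Matrix.one_mulVec]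

/-- Adding the Koszul formula to its transpose cancels every term except twice the derivative of the
metric in direction `a`. -/
theorem conn_metric (hG : G.IsSymm) (hdet : IsUnit G.det) (a : Fin n) :
    G.map (D a) = (conn D G a)ᵀ * G + G * conn D G a := by
  have hT : (conn D G a)ᵀ * G = (G * conn D G a)ᵀ := by rw [Matrix.transpose_mul, hG.eq]
  rw [hT]
  ext i j
  apply two_smul_cancel
  rw [Matrix.add_apply, mul_add, Matrix.transpose_apply, mul_conn_apply hdet, mul_conn_apply hdet,
    Matrix.map_apply, hG.apply i j, hG.apply i a, hG.apply j a]
  ring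

/-- The Levi-Civita connection is the only torsion-free metric connection. -/
theorem eq_conn (hG : G.IsSymm) (hdet : IsUnit G.det) {Γ : Fin n → Matrix (Fin n) (Fin n) A}
    (hsymm : ∀ a b c, Γ a c b = Γ b c a)
    (hmet : ∀ a, G.map (D a) = (Γ a)ᵀ * G + G * Γ a) (a : Fin n) : Γ a = conn D G a := by
  have key : G * Γ a = G * conn D G a := by
    ext e c
    apply two_smul_cancel
    rw [mul_conn_apply hdet]
    have hm : ∀ a i j, D a (G i j) = (G * Γ a) j i + (G * Γ a) i j := by
      intro a i j
      have hT : (Γ a)ᵀ * G = (G * Γ a)ᵀ := by rw [Matrix.transpose_mul, hG.eq]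
      have := congrFun (congrFun (hmet a) i) j
      rwa [hT] at this
    have hs : ∀ a b i, (G * Γ a) i b = (G * Γ b) i a := by
      intro a b i
      simp only [Matrix.mul_apply, hsymm a b]
    -- Koszul's trick: metric compatibility turns the three derivatives into six terms;
    -- torsion-freeness matches them in pairs, so four cancel and the other two are equal.
    rw [hm, hm, hm, hs c a e, hs e a c, hs c e a]
    ring
  have := congrArg (G⁻¹ * ·) key
  simpa [← Matrix.mul_assoc, Matrix.nonsing_inv_mul _ hdet] using this

theorem curv_antisymm (Γ : Fin n → Matrix (Fin n) (Fin n) A) (a b : Fin n) :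
    curv D Γ a b = -curv D Γ b a := by
  unfold curv; abel

/-- The second Bianchi identity. -/
theorem bianchi_second (hD : ∀ a b x, D a (D b x) = D b (D a x))
    (Γ : Fin n → Matrix (Fin n) (Fin n) A) (a b c : Fin n) :
    ((curv D Γ a b).map (D c) + (Γ c * curv D Γ a b - curv D Γ a b * Γ c)) +
      ((curv D Γ b c).map (D a) + (Γ a * curv D Γ b c - curv D Γ b c * Γ a)) +
      ((curv D Γ c a).map (D b) + (Γ b * curv D Γ c a - curv D Γ c a * Γ b)) = 0 := by
  simp only [curv, Derivation.matrix_map_add, Derivation.matrix_map_sub, Derivation.matrix_map_mul]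
  rw [matrix_map_comm hD a c (Γ b), matrix_map_comm hD b c (Γ a), matrix_map_comm hD a b (Γ c)]
  noncomm_ring

/-- The first Bianchi identity. -/
theorem bianchi_first {Γ : Fin n → Matrix (Fin n) (Fin n) A}
    (hsymm : ∀ a b c, Γ a c b = Γ b c a) (a b c d : Fin n) :
    curv D Γ a b d c + curv D Γ b c d a + curv D Γ c a d b = 0 := by
  simp only [curv, Matrix.add_apply, Matrix.sub_apply, Matrix.map_apply, Matrix.mul_apply]
  rw [hsymm b c d, hsymm a c d, hsymm a b d]
  simp only [hsymm b c, hsymm a c, hsymm a b]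
  ring

/-- The curvature of a metric connection is skew with respect to the metric. -/
theorem curv_skew (hD : ∀ a b x, D a (D b x) = D b (D a x))
    {Γ : Fin n → Matrix (Fin n) (Fin n) A}
    (hmet : ∀ a, G.map (D a) = (Γ a)ᵀ * G + G * Γ a) (a b : Fin n) :
    (curv D Γ a b)ᵀ * G + G * curv D Γ a b = 0 := by
  -- The commutator of `D a` and `D b` kills `G`; expanding both second derivatives by metric
  -- compatibility leaves exactly the curvature terms.
  have h := matrix_map_comm hD a b G
  rw [hmet a, hmet b] at h
  simp only [Derivation.matrix_map_add, Derivation.matrix_map_mul, hmet] at h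
  have h2 := sub_eq_zero.mpr h.symm
  rw [← h2]
  simp only [curv, Matrix.transpose_add, Matrix.transpose_sub, Matrix.transpose_mul,
    Matrix.transpose_map]
  noncomm_ring

/-- The constant curvature model `(T_ab)ᶠ_c = G_ac δᶠ_b - G_bc δᶠ_a`. -/
def model (G : Matrix (Fin n) (Fin n) A) (a b : Fin n) : Matrix (Fin n) (Fin n) A :=
  Matrix.of fun f c => G a c * (1 : Matrix (Fin n) (Fin n) A) f b -
    G b c * (1 : Matrix (Fin n) (Fin n) A) f a

theorem derivation_one_apply (d : Derivation ℝ A A) (i j : Fin n) :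
    d ((1 : Matrix (Fin n) (Fin n) A) i j) = 0 := by
  rw [Matrix.one_apply]; split_ifs <;> simp

/-- The covariant derivative of the constant curvature model, as an endomorphism-valued form. -/
theorem model_covariant {Γ : Fin n → Matrix (Fin n) (Fin n) A}
    (hmet : ∀ a, G.map (D a) = (Γ a)ᵀ * G + G * Γ a) (e a b : Fin n) :
    (model G a b).map (D e) + (Γ e * model G a b - model G a b * Γ e) =
      ∑ h, (Γ e h a • model G h b + Γ e h b • model G a h) := by
  -- The model is built from `G` and the identity, both parallel, so its full covariant derivative
  -- is zero. The left side corrects only the endomorphism indices; the right side is the correction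
  -- for the form indices `a`, `b`.
  have hm : ∀ i j, D e (G i j) = ∑ x, Γ e x i * G x j + ∑ x, G i x * Γ e x j := fun i j => by
    have := congrFun (congrFun (hmet e) i) j
    simpa [Matrix.mul_apply] using this
  ext f c
  simp only [model, Matrix.add_apply, Matrix.sub_apply, Matrix.map_apply, Matrix.mul_apply,
    Matrix.of_apply, Matrix.sum_apply, Matrix.smul_apply, smul_eq_mul, map_sub, Derivation.leibniz,
    derivation_one_apply, hm, mul_sub, sub_mul, Finset.sum_add_distrib, Finset.sum_sub_distrib]
  have h2 : ∀ (p : A) (b : Fin n), ∑ x, Γ e f x * (p * (1 : Matrix (Fin n) (Fin n) A) x b) =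
      p * Γ e f b := fun p b => by simp [Matrix.one_apply, mul_comm]
  have h3 : ∀ (p : A) (b : Fin n), ∑ x, Γ e x b * (p * (1 : Matrix (Fin n) (Fin n) A) f x) =
      p * Γ e f b := fun p b => by simp [Matrix.one_apply, mul_comm]
  have h4 : ∀ (a : Fin n) (δ : A), ∑ x, G a x * δ * Γ e x c = δ * ∑ x, G a x * Γ e x c :=
    fun a δ => by rw [Finset.mul_sum]; exact Finset.sum_congr rfl fun x _ => by ring
  have h5 : ∀ (a : Fin n) (δ : A), ∑ x, Γ e x a * (G x c * δ) = δ * ∑ x, Γ e x a * G x c :=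
    fun a δ => by rw [Finset.mul_sum]; exact Finset.sum_congr rfl fun x _ => by ring
  simp only [h2, h3, h4, h5]
  ring

/-- Schur's lemma: if the curvature of a torsion-free metric connection is `k` times the constant
curvature model, then `k` is constant in dimension at least three. -/
theorem schur (hn : 3 ≤ n) (hD : ∀ a b x, D a (D b x) = D b (D a x)) (hdet : IsUnit G.det)
    {Γ : Fin n → Matrix (Fin n) (Fin n) A} (hsymm : ∀ a b c, Γ a c b = Γ b c a)
    (hmet : ∀ a, G.map (D a) = (Γ a)ᵀ * G + G * Γ a) {k : A}
    (hk : ∀ a b, curv D Γ a b = k • model G a b) (e : Fin n) : D e k = 0 := by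
  have hanti : ∀ a b, model G a b = -model G b a := fun a b => by
    ext f c; simp [model]
  have hcov : ∀ e a b, (curv D Γ a b).map (D e) +
      (Γ e * curv D Γ a b - curv D Γ a b * Γ e) = D e k • model G a b +
      k • ∑ h, (Γ e h a • model G h b + Γ e h b • model G a h) := fun e a b => by
    rw [← model_covariant hmet, hk]
    have : (k • model G a b).map (D e) = D e k • model G a b + k • (model G a b).map (D e) := by
      ext i j; simp [mul_comm, add_comm]
    rw [this]
    simp only [Matrix.mul_smul, Matrix.smul_mul, smul_add, smul_sub]
    abel
  have hcyc : ∀ e a b, D e k • model G a b + D a k • model G b e + D b k • model G e a = 0 := by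
    intro e a b
    have h := bianchi_second hD Γ a b e
    rw [hcov, hcov, hcov] at h
    -- Torsion-freeness makes the corrections for the form indices cancel in the cyclic sum, so only
    -- the derivatives of `k` remain in the Bianchi identity.
    have hz : (∑ h, (Γ e h a • model G h b + Γ e h b • model G a h)) +
        (∑ h, (Γ a h b • model G h e + Γ a h e • model G b h)) +
        (∑ h, (Γ b h e • model G h a + Γ b h a • model G e h)) = 0 := by
      rw [← Finset.sum_add_distrib, ← Finset.sum_add_distrib]
      refine Finset.sum_eq_zero fun h _ => ?_
      rw [hsymm e a h, hsymm e b h, hsymm a b h, hanti h b, hanti h e, hanti h a]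
      module
    have h2 := congrArg (k • ·) hz
    simp only [smul_add, smul_zero] at h2
    rw [← h, ← sub_eq_zero]
    rw [← neg_eq_zero, ← h2]
    abel
  -- The hypothesis n ≥ 3 enters here: `e`, `a`, `b` are to be pairwise distinct.
  obtain ⟨a, hae⟩ : ∃ a : Fin n, a ≠ e := by
    by_cases h : e = ⟨0, by omega⟩
    · exact ⟨⟨1, by omega⟩, by simp [h]⟩
    · exact ⟨⟨0, by omega⟩, Ne.symm h⟩
  obtain ⟨b, hbe, hba⟩ : ∃ b : Fin n, b ≠ e ∧ b ≠ a := by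
    by_contra! h
    have : (Finset.univ : Finset (Fin n)) ⊆ {e, a} := fun b _ => by
      by_cases hb : b = e
      · simp [hb]
      · simp [h b hb]
    have := (Finset.card_le_card this).trans Finset.card_le_two
    rw [Finset.card_fin] at this
    omega
  -- In row `b` of the cyclic identity, T_ab contributes G_ac, T_be contributes -G_ec and T_ea
  -- contributes 0. Contracting with column `a` of the inverse metric then isolates `D e k`.
  have hrow : ∀ c, D e k * G a c - D a k * G e c = 0 := fun c => by
    have := congrFun (congrFun (hcyc e a b) b) c
    simpa [model, Matrix.one_apply, hba, hbe, sub_eq_add_neg] using this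
  have hinv : ∀ i j, ∑ c, G i c * G⁻¹ c j = (1 : Matrix (Fin n) (Fin n) A) i j := fun i j => by
    rw [← Matrix.mul_apply, Matrix.mul_nonsing_inv _ hdet]
  have hs : ∑ c, (D e k * G a c - D a k * G e c) * G⁻¹ c a = 0 := by simp [hrow]
  simp only [sub_mul, mul_assoc, Finset.sum_sub_distrib, ← Finset.mul_sum, hinv] at hs
  simpa [Matrix.one_apply, hae.symm] using hs

/-! ### Behaviour of connection and curvature under coordinate changes -/

section ChangeOfCoordinates

variable {A' : Type*} [CommRing A'] [Algebra ℝ A'] {D' : Fin n → Derivation ℝ A' A'}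
  {G' : Matrix (Fin n) (Fin n) A'} {τ : A' →+* A} {J : Matrix (Fin n) (Fin n) A}

/-- The pullback of connection matrices under a change of coordinates with Jacobian `J`. -/
def pullConn (τ : A' →+* A) (J : Matrix (Fin n) (Fin n) A)
    (Γ' : Fin n → Matrix (Fin n) (Fin n) A') (a : Fin n) : Matrix (Fin n) (Fin n) A :=
  ∑ i, J i a • (Γ' i).map τ

/-- Naturality of curvature: the chain rule `hτ` produces the pulled back derivatives, and the terms
that differentiate `J` cancel because second derivatives of the coordinate change are symmetric
(`hJ`). -/
theorem curv_pullConn (hJ : ∀ a i c, D a (J i c) = D c (J i a))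
    (hτ : ∀ a f, D a (τ f) = ∑ i, J i a * τ (D' i f))
    (Γ' : Fin n → Matrix (Fin n) (Fin n) A') (a b : Fin n) :
    curv D (pullConn τ J Γ') a b =
      ∑ i, ∑ j, (J i a * J j b) • (curv D' Γ' i j).map τ := by
  have h1 : ∀ a b, (pullConn τ J Γ' b).map (D a) =
      (∑ j, D a (J j b) • (Γ' j).map τ) +
        ∑ i, ∑ j, (J i a * J j b) • ((Γ' j).map (D' i)).map τ := by
    intro a b
    ext x y
    simp only [pullConn, Matrix.map_apply, Matrix.sum_apply, Matrix.smul_apply, map_sum,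
      Derivation.leibniz, smul_eq_mul, Matrix.add_apply, hτ, Finset.sum_add_distrib]
    rw [add_comm, Finset.sum_comm (γ := Fin n)]
    congr 1
    · exact Finset.sum_congr rfl fun j _ => mul_comm _ _
    · refine Finset.sum_congr rfl fun j _ => ?_
      rw [Finset.mul_sum]
      exact Finset.sum_congr rfl fun i _ => by ring
  have h2 : ∀ a b, pullConn τ J Γ' a * pullConn τ J Γ' b =
      ∑ i, ∑ j, (J i a * J j b) • ((Γ' i) * (Γ' j)).map τ := by
    intro a b
    simp only [pullConn, Finset.sum_mul, Finset.mul_sum, Matrix.smul_mul, Matrix.mul_smul,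
      smul_smul, Matrix.map_mul]
    rw [Finset.sum_comm]
    refine Finset.sum_congr rfl fun i _ => Finset.sum_congr rfl fun j _ => by rw [mul_comm]
  have hswap : ∀ F : Fin n → Fin n → Matrix (Fin n) (Fin n) A,
      ∑ i, ∑ j, (J i b * J j a) • F i j = ∑ i, ∑ j, (J i a * J j b) • F j i := by
    intro F
    rw [Finset.sum_comm]
    exact Finset.sum_congr rfl fun i _ => Finset.sum_congr rfl fun j _ => by rw [mul_comm]
  unfold curv
  rw [h1, h1, h2, h2, hswap, hswap]
  have h3 : ∀ j, D b (J j a) = D a (J j b) := fun j => hJ b j a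
  simp only [h3]
  rw [add_sub_add_left_eq_sub]
  simp only [← Finset.sum_sub_distrib, ← Finset.sum_add_distrib, ← smul_sub, ← smul_add]
  refine Finset.sum_congr rfl fun i _ => Finset.sum_congr rfl fun j _ => ?_
  congr 1
  ext x y
  simp [-Matrix.map_mul]

/-- The curvature under a gauge transformation. -/
theorem curv_gauge (hD : ∀ a b x, D a (D b x) = D b (D a x))
    {Γ Θ : Fin n → Matrix (Fin n) (Fin n) A} (h : ∀ a, J * Γ a = Θ a * J + J.map (D a))
    (a b : Fin n) : J * curv D Γ a b = curv D Θ a b * J := by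
  have h1 : ∀ a b, J.map (D b) * Γ a + J * (Γ a).map (D b) =
      (Θ a).map (D b) * J + Θ a * J.map (D b) + (J.map (D a)).map (D b) := by
    intro a b
    rw [← Derivation.matrix_map_mul, h, Derivation.matrix_map_add, Derivation.matrix_map_mul]
  have h2 : ∀ a b, J * (Γ a).map (D b) = (Θ a).map (D b) * J + Θ a * J.map (D b) +
      (J.map (D a)).map (D b) - J.map (D b) * Γ a := fun a b => eq_sub_of_add_eq' (h1 a b)
  have h3 : ∀ a b, J * (Γ a * Γ b) = Θ a * (Θ b * J + J.map (D b)) + J.map (D a) * Γ b := by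
    intro a b
    rw [← mul_assoc, h, add_mul, mul_assoc, h]
  unfold curv
  rw [mul_add, mul_sub, mul_sub, h2, h2, h3, h3, matrix_map_comm hD a b J]
  noncomm_ring

/-- The curvature tensor of the metric `G = Jᵀ (τ G') J` is the pullback of that of `G'`. -/
theorem curv_change (hD : ∀ a b x, D a (D b x) = D b (D a x))
    (hJ : ∀ a i c, D a (J i c) = D c (J i a)) (hJu : IsUnit J.det)
    (hτ : ∀ a f, D a (τ f) = ∑ i, J i a * τ (D' i f))
    (hG : G.IsSymm) (hdet : IsUnit G.det) (hG' : G'.IsSymm) (hdet' : IsUnit G'.det)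
    (hGG : G = Jᵀ * G'.map τ * J) (a b : Fin n) :
    G * curv D (conn D G) a b = ∑ i, ∑ j, (J i a * J j b) •
      (Jᵀ * (G' * curv D' (conn D' G') i j).map τ * J) := by
  -- `Θ` is the connection of `G'` in the pulled back frame of the new coordinates. Passing to the
  -- old coordinate frame is a gauge transformation by `J`, giving `Γ` below.
  set Θ := pullConn τ J (conn D' G') with hΘ
  have hinv : J * J⁻¹ = 1 := Matrix.mul_nonsing_inv _ hJu
  have hs' : ∀ a b c, conn D' G' a c b = conn D' G' b c a := fun a b c => by
    simp only [conn, Matrix.of_apply]; exact christoffel_symm hG' _ _ _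
  have hΘsymm : ∀ a c i, (Θ a * J) i c = (Θ c * J) i a := by
    intro a c i
    simp only [hΘ, pullConn, Matrix.mul_apply, Matrix.sum_apply, Matrix.smul_apply,
      Matrix.map_apply, smul_eq_mul, Finset.sum_mul]
    rw [Finset.sum_comm]
    refine Finset.sum_congr rfl fun x _ => Finset.sum_congr rfl fun y _ => ?_
    rw [hs' y x]
    ring
  have hGτ : ∀ a, (G'.map τ).map (D a) = (Θ a)ᵀ * G'.map τ + G'.map τ * Θ a := by
    intro a
    have h0 : (G'.map τ).map (D a) = ∑ i, J i a • (G'.map (D' i)).map τ := by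
      ext x y
      simp [hτ, Matrix.sum_apply]
    simp only [h0, conn_metric hG' hdet', hΘ, pullConn, Matrix.transpose_sum, Finset.sum_mul,
      Finset.mul_sum, Matrix.transpose_smul, Matrix.smul_mul, Matrix.mul_smul,
      ← Finset.sum_add_distrib, ← smul_add]
    refine Finset.sum_congr rfl fun i _ => ?_
    rw [← Matrix.transpose_map, ← Matrix.map_mul, ← Matrix.map_mul]
    congr 1
    ext x y
    simp [-Matrix.map_mul]
  set Γ : Fin n → Matrix (Fin n) (Fin n) A := fun a => J⁻¹ * (Θ a * J + J.map (D a)) with hΓ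
  have hJΓ : ∀ a, J * Γ a = Θ a * J + J.map (D a) := fun a => by
    rw [hΓ, ← mul_assoc, hinv, one_mul]
  have hΓs : ∀ a b c, Γ a c b = Γ b c a := by
    intro a b c
    simp only [hΓ]
    rw [Matrix.mul_apply, Matrix.mul_apply]
    refine Finset.sum_congr rfl fun x _ => ?_
    rw [Matrix.add_apply, Matrix.add_apply, hΘsymm, Matrix.map_apply, Matrix.map_apply, hJ]
  have hΓm : ∀ a, G.map (D a) = (Γ a)ᵀ * G + G * Γ a := by
    intro a
    have e1 : G * Γ a = Jᵀ * G'.map τ * (Θ a * J + J.map (D a)) := by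
      rw [← hJΓ, hGG, mul_assoc]
    have e2 : (Γ a)ᵀ * G = (Θ a * J + J.map (D a))ᵀ * G'.map τ * J := by
      rw [← hJΓ, hGG, Matrix.transpose_mul J]; noncomm_ring
    rw [e1, e2, hGG, Derivation.matrix_map_mul, Derivation.matrix_map_mul, hGτ,
      Matrix.transpose_add, Matrix.transpose_mul, Matrix.transpose_map]
    noncomm_ring
  -- `Γ` is torsion-free and metric for `G`, so uniqueness identifies it with the Levi-Civita
  -- connection, and no derivative of `G⁻¹` is ever computed.
  have hΓc : conn D G = Γ := funext fun a => (eq_conn hG hdet hΓs hΓm a).symm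
  rw [hΓc]
  have hg := curv_gauge hD hJΓ a b
  rw [hGG, mul_assoc, hg, hΘ, curv_pullConn hJ hτ]
  simp only [Finset.sum_mul, Finset.mul_sum, Matrix.smul_mul, Matrix.mul_smul, Matrix.map_mul,
    mul_assoc]

end ChangeOfCoordinates

end FormalGeometry
end FormalGeometry

/-! ### Algebraic curvature tensors over the reals -/

section CurvatureTensors

variable {n : ℕ}

/-- The quadrilinear form with coefficients `S`. -/
def quadForm {A : Type*} [CommRing A] (S : Fin n → Fin n → Fin n → Fin n → A)
    (x y z w : Fin n → A) : A :=
  ∑ a, ∑ b, ∑ c, ∑ d, S a b c d * x a * y b * z c * w d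

/-- The algebraic symmetries of a curvature tensor. -/
structure IsCurvatureLike {A : Type*} [CommRing A] (S : Fin n → Fin n → Fin n → Fin n → A) :
    Prop where
  skew_left : ∀ a b c d, S a b c d = -S b a c d
  skew_right : ∀ a b c d, S a b c d = -S a b d c
  bianchi : ∀ a b c d, S a b c d + S b c a d + S c a b d = 0

theorem quadForm_single {A : Type*} [CommRing A] (S : Fin n → Fin n → Fin n → Fin n → A)
    (a b c d : Fin n) :
    quadForm S (Pi.single a 1) (Pi.single b 1) (Pi.single c 1) (Pi.single d 1) = S a b c d := by
  simp [quadForm, Pi.single_apply]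

theorem map_quadForm {A B : Type*} [CommRing A] [CommRing B] (f : A →+* B)
    (S : Fin n → Fin n → Fin n → Fin n → A) (x y z w : Fin n → A) :
    f (quadForm S x y z w) = quadForm (fun a b c d => f (S a b c d)) (f ∘ x) (f ∘ y) (f ∘ z)
      (f ∘ w) := by
  simp [quadForm]

/-- A curvature-like tensor is determined by its sectional curvatures. -/
theorem IsCurvatureLike.eq_zero {S : Fin n → Fin n → Fin n → Fin n → ℝ} (hS : IsCurvatureLike S)
    (h : ∀ z w, quadForm S z w z w = 0) (a b c d : Fin n) : S a b c d = 0 := by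
  have add1 : ∀ x x' y z w, quadForm S (x + x') y z w = quadForm S x y z w + quadForm S x' y z w :=
    fun x x' y z w => by
      simp only [quadForm, Pi.add_apply, mul_add, add_mul, Finset.sum_add_distrib]
  have add2 : ∀ x y y' z w, quadForm S x (y + y') z w = quadForm S x y z w + quadForm S x y' z w :=
    fun x y y' z w => by
      simp only [quadForm, Pi.add_apply, mul_add, add_mul, Finset.sum_add_distrib]
  have add3 : ∀ x y z z' w, quadForm S x y (z + z') w = quadForm S x y z w + quadForm S x y z' w :=
    fun x y z z' w => by
      simp only [quadForm, Pi.add_apply, mul_add, add_mul, Finset.sum_add_distrib]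
  have add4 : ∀ x y z w w', quadForm S x y z (w + w') = quadForm S x y z w + quadForm S x y z w' :=
    fun x y z w w' => by
      simp only [quadForm, Pi.add_apply, mul_add, Finset.sum_add_distrib]
  have h1 : ∀ x y w, quadForm S x w y w + quadForm S y w x w = 0 := fun x y w => by
    have := h (x + y) w
    rw [add1, add3, add3, h, h] at this
    linarith
  have h2 : ∀ x y w v, quadForm S x w y v + quadForm S x v y w + quadForm S y w x v +
      quadForm S y v x w = 0 := fun x y w v => by
    have := h1 x y (w + v)
    rw [add2, add2, add4, add4, add4, add4] at this
    linarith [h1 x y w, h1 x y v]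
  -- Polarization in slots one and three, then in two and four, evaluated on basis vectors.
  have h3 : ∀ a b c d, S a b c d + S a d c b + S c b a d + S c d a b = 0 := fun a b c d => by
    have := h2 (Pi.single a 1) (Pi.single c 1) (Pi.single b 1) (Pi.single d 1)
    simpa only [quadForm_single] using this
  -- Pair symmetry follows by combining four Bianchi identities with the two skew symmetries.
  have hpair : ∀ a b c d, S a b c d = S c d a b := fun a b c d => by
    have b1 := hS.bianchi a b c d
    have b2 := hS.bianchi b c d a
    have b3 := hS.bianchi c d a b
    have b4 := hS.bianchi d a b c
    have l := hS.skew_left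
    have r := hS.skew_right
    linarith [r a b c d, r b c a d, r c a b d, l c a b d, l c a d b, r c d a b, l b d c a,
      l b d a c, r b d c a, r d a b c, r c d b a, r b c d a, r a b d c, r d a c b, l a c d b]
  -- By pair symmetry the four terms of `h3` coincide two by two, so `S` is skew in its second and
  -- fourth slots. It is then totally skew, the three terms of the Bianchi identity agree, and 3S =
  -- 0.
  have h4 : ∀ a b c d, S a b c d = -S a d c b := fun a b c d => by
    linarith [h3 a b c d, hpair c b a d, hpair c d a b]
  linarith [hS.bianchi a b c d, h4 a b c d, h4 b c a d, h4 c a b d, hS.skew_left a b c d,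
    hS.skew_right a b c d, hS.skew_left b c a d, hS.skew_right b c a d, hS.skew_left c a b d,
    hS.skew_right c a b d, h4 a b d c, h4 b a c d, h4 c b a d, h4 a c b d, hS.skew_left a d c b,
    hS.skew_right a d c b, hS.skew_left a c b d, h4 a d c b, hpair a b c d, hpair b c a d,
    hpair c a b d, hS.skew_right a c b d, hS.skew_left c b a d]

/-- The quadrilinear form of `S` on repeated arguments, as a polynomial. -/
def quadPoly (S : Fin n → Fin n → Fin n → Fin n → ℝ) : MvPolynomial (Fin n ⊕ Fin n) ℝ :=
  ∑ a, ∑ b, ∑ c, ∑ d, MvPolynomial.C (S a b c d) * MvPolynomial.X (Sum.inl a) *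
    MvPolynomial.X (Sum.inr b) * MvPolynomial.X (Sum.inl c) * MvPolynomial.X (Sum.inr d)

theorem eval_quadPoly (S : Fin n → Fin n → Fin n → Fin n → ℝ) (z w : Fin n → ℝ) :
    MvPolynomial.eval (Sum.elim z w) (quadPoly S) = quadForm S z w z w := by
  simp [quadPoly, quadForm]

theorem IsCurvatureLike.eq_zero_of_quadPoly {S : Fin n → Fin n → Fin n → Fin n → ℝ}
    (hS : IsCurvatureLike S) (h : quadPoly S = 0) (a b c d : Fin n) : S a b c d = 0 :=
  hS.eq_zero (fun z w => by rw [← eval_quadPoly, h, map_zero]) a b c d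

/-- The pairs on which the form of `T` does not vanish are Zariski-dense: the product of the two
polynomials vanishes everywhere, a polynomial ring over ℝ is a domain, and the factor of `T` is
nonzero because sectional values determine `T`. -/
theorem IsCurvatureLike.eq_zero_of_dense {S T : Fin n → Fin n → Fin n → Fin n → ℝ}
    (hS : IsCurvatureLike S) (hT : IsCurvatureLike T) (hT0 : ∃ a b c d, T a b c d ≠ 0)
    (h : ∀ z w, quadForm T z w z w ≠ 0 → quadForm S z w z w = 0) (a b c d : Fin n) :
    S a b c d = 0 := by
  have hprod : quadPoly S * quadPoly T = 0 := by
    refine MvPolynomial.funext fun x => ?_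
    have hx : x = Sum.elim (x ∘ Sum.inl) (x ∘ Sum.inr) := (Sum.elim_comp_inl_inr x).symm
    rw [map_mul, map_zero, hx, eval_quadPoly, eval_quadPoly]
    by_cases h0 : quadForm T (x ∘ Sum.inl) (x ∘ Sum.inr) (x ∘ Sum.inl) (x ∘ Sum.inr) = 0
    · rw [h0, mul_zero]
    · rw [h _ _ h0, zero_mul]
  rcases mul_eq_zero.mp hprod with h0 | h0
  · exact hS.eq_zero_of_quadPoly h0 a b c d
  · obtain ⟨a, b, c, d, h1⟩ := hT0
    exact absurd (hT.eq_zero_of_quadPoly h0 a b c d) h1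

/-- The curvature tensor of constant curvature one for the metric `G`. -/
def unitCurvature {A : Type*} [CommRing A] (G : Matrix (Fin n) (Fin n) A) (a b c d : Fin n) : A :=
  G a c * G b d - G b c * G a d

theorem isCurvatureLike_unitCurvature {A : Type*} [CommRing A] {G : Matrix (Fin n) (Fin n) A}
    (hG : G.IsSymm) : IsCurvatureLike (unitCurvature G) where
  skew_left a b c d := by unfold unitCurvature; ring
  skew_right a b c d := by unfold unitCurvature; ring
  bianchi a b c d := by
    unfold unitCurvature
    rw [hG.apply a b, hG.apply b c, hG.apply a c]
    ring

/-- Contracting the entries T_abcd with G⁻¹_ca G⁻¹_db for two distinct indices `a`, `b` gives 1, so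
they cannot all vanish. -/
theorem exists_unitCurvature_ne_zero (hn : 2 ≤ n) {G : Matrix (Fin n) (Fin n) ℝ}
    (hdet : IsUnit G.det) : ∃ a b c d, unitCurvature G a b c d ≠ 0 := by
  by_contra! h
  let a : Fin n := ⟨0, by omega⟩
  let b : Fin n := ⟨1, by omega⟩
  have hab : a ≠ b := by simp [a, b]
  have hinv : ∀ i j, ∑ c, G i c * G⁻¹ c j = (1 : Matrix (Fin n) (Fin n) ℝ) i j := fun i j => by
    rw [← Matrix.mul_apply, Matrix.mul_nonsing_inv _ hdet]
  have h1 : ∑ c, ∑ d, unitCurvature G a b c d * (G⁻¹ c a * G⁻¹ d b) =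
      (∑ c, G a c * G⁻¹ c a) * (∑ d, G b d * G⁻¹ d b) -
        (∑ c, G b c * G⁻¹ c a) * (∑ d, G a d * G⁻¹ d b) := by
    simp only [Finset.sum_mul_sum, ← Finset.sum_sub_distrib, unitCurvature]
    exact Finset.sum_congr rfl fun c _ => Finset.sum_congr rfl fun d _ => by ring
  simp [h, hinv, Matrix.one_apply, hab] at h1

end CurvatureTensors

/-! ### Para-complex numbers as a product of two copies of the reals -/

namespace ParaComplex

/-- The ring homomorphism `x + ey ↦ x + sy` for a sign `s`. -/
def proj (s : ℝ) (hs : s * s = 1) : ParaComplex →+* ℝ where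
  toFun z := z.re + s * z.im
  map_one' := by simp [QuadraticAlgebra.re_one, QuadraticAlgebra.im_one]
  map_zero' := by simp
  map_add' z w := by simp; ring
  map_mul' z w := by simp; linear_combination (-z.im * w.im) * hs

theorem proj_apply (s : ℝ) (hs : s * s = 1) (z : ParaComplex) : proj s hs z = z.re + s * z.im := rfl

/-- The projections for `s` and `-s` are the two factors of C ≅ ℝ × ℝ. Keeping the sign variable
lets one argument serve both factors. -/
theorem ext_proj {s : ℝ} (hs : s * s = 1) (hs' : -s * -s = 1) {z w : ParaComplex}
    (h : proj s hs z = proj s hs w) (h' : proj (-s) hs' z = proj (-s) hs' w) : z = w := by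
  simp only [proj_apply] at h h'
  have him : s * z.im = s * w.im := by linarith
  ext
  · linarith
  · linear_combination s * him + (w.im - z.im) * hs

theorem exists_proj {s : ℝ} (hs : s * s = 1) (hs' : -s * -s = 1) (x y : ℝ) :
    ∃ z : ParaComplex, proj s hs z = x ∧ proj (-s) hs' z = y := by
  refine ⟨⟨(x + y) / 2, s * (x - y) / 2⟩, ?_, ?_⟩ <;> simp only [proj_apply]
  · linear_combination ((x - y) / 2) * hs
  · linear_combination (-(x - y) / 2) * hs

theorem isUnit_iff {s : ℝ} (hs : s * s = 1) (hs' : -s * -s = 1) {z : ParaComplex} :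
    IsUnit z ↔ proj s hs z ≠ 0 ∧ proj (-s) hs' z ≠ 0 := by
  constructor
  · intro h
    exact ⟨(h.map _).ne_zero, (h.map _).ne_zero⟩
  · rintro ⟨h, h'⟩
    obtain ⟨w, h1, h2⟩ := exists_proj hs hs' (proj s hs z)⁻¹ (proj (-s) hs' z)⁻¹
    refine IsUnit.of_mul_eq_one w (ext_proj hs hs' ?_ ?_)
    · rw [map_mul, h1, map_one, mul_inv_cancel₀ h]
    · rw [map_mul, h2, map_one, mul_inv_cancel₀ h']

/-- A curvature-like tensor over `C` with constant sectional curvature `k` is `k` times the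
curvature tensor of constant curvature one. -/
theorem eq_unitCurvature {n : ℕ} (hn : 2 ≤ n) {R : Fin n → Fin n → Fin n → Fin n → ParaComplex}
    {G : Matrix (Fin n) (Fin n) ParaComplex} {k : ParaComplex} (hR : IsCurvatureLike R)
    (hG : G.IsSymm) (hdet : IsUnit G.det)
    (h : ∀ z w, IsUnit (quadForm (unitCurvature G) z w z w) →
      quadForm R z w z w = k * quadForm (unitCurvature G) z w z w) (a b c d : Fin n) :
    R a b c d = k * unitCurvature G a b c d := by
  have key : ∀ (s : ℝ) (hs : s * s = 1), proj s hs (R a b c d - k * unitCurvature G a b c d) = 0 := by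
    intro s hs
    have hs' : -s * -s = 1 := by rw [neg_mul_neg, hs]
    have hT := isCurvatureLike_unitCurvature hG
    have hmap : ∀ (t : ℝ) (ht : t * t = 1), (fun a b c d => proj t ht (unitCurvature G a b c d)) =
        unitCurvature (G.map (proj t ht)) := by
      intro t ht; funext a b c d; simp [unitCurvature]
    have hTs : ∀ (t : ℝ) (ht : t * t = 1), IsCurvatureLike (unitCurvature (G.map (proj t ht))) :=
      fun t ht => isCurvatureLike_unitCurvature (hG.map _)
    have hT0 : ∀ (t : ℝ) (ht : t * t = 1), ∃ a b c d, unitCurvature (G.map (proj t ht)) a b c d ≠ 0 :=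
      fun t ht => exists_unitCurvature_ne_zero hn (by
        have := hdet.map (proj t ht)
        rwa [RingHom.map_det] at this)
    -- The hypothesis only speaks of invertible Gram determinants, which must be nonzero in both
    -- factors. A pair nondegenerate in the factor `-s` is fixed once and glued to every
    -- nondegenerate pair in the factor `s`.
    obtain ⟨z', w', h'⟩ : ∃ z' w', quadForm (unitCurvature (G.map (proj (-s) hs'))) z' w' z' w' ≠ 0 := by
      by_contra! hcon
      obtain ⟨a, b, c, d, h0⟩ := hT0 (-s) hs'
      exact h0 ((hTs (-s) hs').eq_zero hcon a b c d)
    refine IsCurvatureLike.eq_zero_of_dense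
      (S := fun a b c d => proj s hs (R a b c d - k * unitCurvature G a b c d)) ?_ (hTs s hs)
      (hT0 s hs) ?_ a b c d
    · refine ⟨fun a b c d => ?_, fun a b c d => ?_, fun a b c d => ?_⟩
      · rw [hR.skew_left, hT.skew_left, ← map_neg]; congr 1; ring
      · rw [hR.skew_right, hT.skew_right, ← map_neg]; congr 1; ring
      · rw [← map_add, ← map_add]
        refine Eq.trans (congrArg _ ?_) (map_zero _)
        linear_combination hR.bianchi a b c d - k * hT.bianchi a b c d
    · intro z w hzw
      choose Z hZ hZ' using fun a => exists_proj hs hs' (z a) (z' a)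
      choose W hW hW' using fun a => exists_proj hs hs' (w a) (w' a)
      have e1 : proj s hs ∘ Z = z := funext hZ
      have e2 : proj s hs ∘ W = w := funext hW
      have e3 : proj (-s) hs' ∘ Z = z' := funext hZ'
      have e4 : proj (-s) hs' ∘ W = w' := funext hW'
      have hu : IsUnit (quadForm (unitCurvature G) Z W Z W) := by
        rw [isUnit_iff hs hs', map_quadForm, map_quadForm, hmap, hmap, e1, e2, e3, e4]
        exact ⟨hzw, h'⟩
      have h0 : quadForm (fun a b c d => R a b c d - k * unitCurvature G a b c d) Z W Z W = 0 := by
        rw [← sub_eq_zero.mpr (h Z W hu)]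
        simp only [quadForm, Finset.mul_sum, ← Finset.sum_sub_distrib]
        exact Finset.sum_congr rfl fun a _ => Finset.sum_congr rfl fun b _ =>
          Finset.sum_congr rfl fun c _ => Finset.sum_congr rfl fun d _ => by ring
      have h1 := congrArg (proj s hs) h0
      rwa [map_quadForm, e1, e2, map_zero] at h1
  have h1 : (1 : ℝ) * 1 = 1 := by norm_num
  have h2 : -(1 : ℝ) * -1 = 1 := by norm_num
  refine sub_eq_zero.mp (ext_proj h1 h2 ?_ ?_) <;> rw [map_zero, key]

end ParaComplex

namespace ParaComplex

theorem e_mul_e : e * e = 1 := by ext <;> simp [e, QuadraticAlgebra.re_one, QuadraticAlgebra.im_one]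

theorem eq_smul_add (z : ParaComplex) : z = z.re • (1 : ParaComplex) + z.im • e := by
  ext <;> simp [e, QuadraticAlgebra.re_one, QuadraticAlgebra.im_one]

/-- Multiplication as a continuous bilinear map. -/
def mulL : ParaComplex →L[ℝ] ParaComplex →L[ℝ] ParaComplex :=
  LinearMap.toContinuousLinearMap
    ((LinearMap.toContinuousLinearMap (𝕜 := ℝ) (E := ParaComplex) (F' := ParaComplex)).toLinearMap ∘ₗ
      LinearMap.mul ℝ ParaComplex)

/-- The squared norm `x² - y²` of `x + ey`. -/
def normSq (z : ParaComplex) : ℝ := z.re * z.re - z.im * z.im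

theorem mul_conj (z : ParaComplex) : z * conj z = normSq z • (1 : ParaComplex) := by
  ext <;> simp [conj, normSq, QuadraticAlgebra.re_one, QuadraticAlgebra.im_one] <;> ring

theorem normSq_ne_zero {z : ParaComplex} (hz : IsUnit z) : normSq z ≠ 0 := by
  have h := (isUnit_iff (s := 1) (by norm_num) (by norm_num)).mp hz
  simp only [proj_apply] at h
  have : normSq z = (z.re + 1 * z.im) * (z.re + -1 * z.im) := by unfold normSq; ring
  rw [this]
  exact mul_ne_zero h.1 h.2

end ParaComplex

/-! ### The para-Cauchy-Riemann equations -/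

section ParaLinear

variable {n : ℕ}

theorem map_smul_of_map_e_smul {L : ParaSpace n →ₗ[ℝ] ParaComplex}
    (hL : ∀ w, L (e • w) = e * L w) (c : ParaComplex) (w : ParaSpace n) : L (c • w) = c * L w := by
  conv_lhs => rw [eq_smul_add c, add_smul, smul_assoc, smul_assoc, one_smul, map_add, map_smul,
    map_smul, hL]
  conv_rhs => rw [eq_smul_add c, add_mul, smul_mul_assoc, smul_mul_assoc, one_mul]

theorem eq_sum_of_map_e_smul {L : ParaSpace n →ₗ[ℝ] ParaComplex}
    (hL : ∀ w, L (e • w) = e * L w) (w : ParaSpace n) :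
    L w = ∑ i, w i * L (Pi.single i 1) := by
  have : w = ∑ i, w i • (Pi.single i (1 : ParaComplex) : ParaSpace n) := by
    funext j; simp [Finset.sum_apply, Pi.single_apply]
  conv_lhs => rw [this, map_sum]
  exact Finset.sum_congr rfl fun i _ => map_smul_of_map_e_smul hL _ _

theorem map_e_smul_of_single {L : ParaSpace n →ₗ[ℝ] ParaComplex}
    (h : ∀ c, L (Pi.single c e) = e * L (Pi.single c 1)) (w : ParaSpace n) :
    L (e • w) = e * L w := by
  have hs : ∀ (c : Fin n) (z : ParaComplex), L (Pi.single c z) = z * L (Pi.single c 1) := by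
    intro c z
    have : (Pi.single c z : ParaSpace n) =
        z.re • (Pi.single c 1 : ParaSpace n) + z.im • (Pi.single c e : ParaSpace n) := by
      rw [← Pi.single_smul, ← Pi.single_smul, ← Pi.single_add, ← eq_smul_add]
    rw [this, map_add, map_smul, map_smul, h]
    conv_rhs => rw [eq_smul_add z, add_mul, smul_mul_assoc, smul_mul_assoc, one_mul]
  have hw : ∀ w : ParaSpace n, L w = ∑ c, w c * L (Pi.single c 1) := fun w => by
    conv_lhs => rw [← Finset.univ_sum_single w, map_sum]
    exact Finset.sum_congr rfl fun c _ => hs c _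
  rw [hw (e • w), hw w, Finset.mul_sum]
  exact Finset.sum_congr rfl fun c _ => by rw [Pi.smul_apply, smul_eq_mul, mul_assoc]

/-- Multiplying ∂f/∂x = e ∂f/∂y by `e` gives ∂f/∂y = e ∂f/∂x, which is C-linearity of the
differential on each coordinate line. -/
theorem fderiv_e_smul_of_partialZBar {f : ParaSpace n → ParaComplex} {u : ParaSpace n}
    (h : ∀ c, partialZBar c f u = 0) (w : ParaSpace n) :
    fderiv ℝ f u (e • w) = e * fderiv ℝ f u w := by
  refine map_e_smul_of_single (L := (fderiv ℝ f u).toLinearMap) (fun c => ?_) w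
  have h1 := (smul_eq_zero.mp (h c)).resolve_left (by norm_num)
  have h2 := congrArg (e * ·) (sub_eq_zero.mp h1)
  simp only [← mul_assoc, e_mul_e, one_mul] at h2
  exact h2.symm

/-- On para-holomorphic functions ∂/∂z is the plain real derivative along x; all later computations
use that form. -/
theorem partialZ_eq {f : ParaSpace n → ParaComplex} {u : ParaSpace n}
    (h : ∀ w, fderiv ℝ f u (e • w) = e * fderiv ℝ f u w) (a : Fin n) :
    partialZ a f u = fderiv ℝ f u (Pi.single a 1) := by
  have h1 : (Pi.single a e : ParaSpace n) = e • (Pi.single a 1 : ParaSpace n) := by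
    rw [← Pi.single_smul, smul_eq_mul, mul_one]
  rw [partialZ, h1, h, ← mul_assoc, e_mul_e, one_mul, ← two_smul ℝ, smul_smul]
  norm_num

end ParaLinear

/-! ### Para-holomorphic functions and their algebra -/

variable {n : ℕ}

/-- `f` is para-holomorphic on `U`. -/
structure IsParaHolomorphicOn (f : ParaSpace n → ParaComplex) (U : Set (ParaSpace n)) : Prop where
  contDiffOn : ContDiffOn ℝ ∞ f U
  fderiv_e_smul : ∀ u ∈ U, ∀ w, fderiv ℝ f u (e • w) = e * fderiv ℝ f u w

namespace IsParaHolomorphicOn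

variable {f g : ParaSpace n → ParaComplex} {U : Set (ParaSpace n)}

theorem contDiffAt (hf : IsParaHolomorphicOn f U) (hU : IsOpen U) {u : ParaSpace n} (hu : u ∈ U) :
    ContDiffAt ℝ ∞ f u := hf.contDiffOn.contDiffAt (hU.mem_nhds hu)

theorem differentiableAt (hf : IsParaHolomorphicOn f U) (hU : IsOpen U) {u : ParaSpace n}
    (hu : u ∈ U) : DifferentiableAt ℝ f u := (hf.contDiffAt hU hu).differentiableAt (by simp)

theorem congr (hf : IsParaHolomorphicOn f U) (hU : IsOpen U) (h : ∀ u ∈ U, g u = f u) :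
    IsParaHolomorphicOn g U where
  contDiffOn := hf.contDiffOn.congr h
  fderiv_e_smul u hu w := by
    have : g =ᶠ[𝓝 u] f := Filter.eventually_of_mem (hU.mem_nhds hu) h
    rw [this.fderiv_eq, hf.fderiv_e_smul u hu]

theorem const (c : ParaComplex) : IsParaHolomorphicOn (fun _ : ParaSpace n => c) U where
  contDiffOn := contDiffOn_const
  fderiv_e_smul u _ w := by simp

theorem add (hf : IsParaHolomorphicOn f U) (hg : IsParaHolomorphicOn g U) (hU : IsOpen U) :
    IsParaHolomorphicOn (f + g) U where
  contDiffOn := hf.contDiffOn.add hg.contDiffOn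
  fderiv_e_smul u hu w := by
    rw [fderiv_add (hf.differentiableAt hU hu) (hg.differentiableAt hU hu)]
    simp only [add_apply, hf.fderiv_e_smul u hu, hg.fderiv_e_smul u hu, mul_add]

/-- The norm on C is the sup norm of ℝ × ℝ, which is not submultiplicative ((1 + e)² = 2(1 + e)), so
the product rule is taken from the continuous bilinear map `mulL`. -/
theorem fderiv_mul_apply {u : ParaSpace n} (hf : DifferentiableAt ℝ f u)
    (hg : DifferentiableAt ℝ g u) (w : ParaSpace n) :
    fderiv ℝ (f * g) u w = f u * fderiv ℝ g u w + fderiv ℝ f u w * g u := by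
  have h : HasFDerivAt (f * g) _ u := mulL.hasFDerivAt_of_bilinear hf.hasFDerivAt hg.hasFDerivAt
  rw [h.fderiv]
  rfl

theorem mul (hf : IsParaHolomorphicOn f U) (hg : IsParaHolomorphicOn g U) (hU : IsOpen U) :
    IsParaHolomorphicOn (f * g) U where
  contDiffOn := (mulL.contDiff.comp_contDiffOn hf.contDiffOn).clm_apply hg.contDiffOn
  fderiv_e_smul u hu w := by
    rw [fderiv_mul_apply (hf.differentiableAt hU hu) (hg.differentiableAt hU hu),
      fderiv_mul_apply (hf.differentiableAt hU hu) (hg.differentiableAt hU hu),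
      hf.fderiv_e_smul u hu, hg.fderiv_e_smul u hu]
    ring

/-- Smoothness is read off from the formula conj f / normSq f. That formula hides para-holomorphy,
which comes instead from differentiating f g = 1 along `w` and along `e • w`. -/
theorem exists_inverse (hf : IsParaHolomorphicOn f U) (hU : IsOpen U)
    (h : ∀ u ∈ U, IsUnit (f u)) :
    ∃ g, IsParaHolomorphicOn g U ∧ ∀ u ∈ U, f u * g u = 1 := by
  let reL : ParaComplex →L[ℝ] ℝ := LinearMap.toContinuousLinearMap (QuadraticAlgebra.reₗ 1 0)
  let imL : ParaComplex →L[ℝ] ℝ := LinearMap.toContinuousLinearMap (QuadraticAlgebra.imₗ 1 0)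
  let conjL : ParaComplex →L[ℝ] ParaComplex := LinearMap.toContinuousLinearMap ParaComplex.conj
  let g : ParaSpace n → ParaComplex := fun u => (normSq (f u))⁻¹ • ParaComplex.conj (f u)
  have hN : ContDiffOn ℝ ∞ (fun u => normSq (f u)) U := by
    have h1 : ContDiffOn ℝ ∞ (fun u => (f u).re) U := reL.contDiff.comp_contDiffOn hf.contDiffOn
    have h2 : ContDiffOn ℝ ∞ (fun u => (f u).im) U := imL.contDiff.comp_contDiffOn hf.contDiffOn
    exact (h1.mul h1).sub (h2.mul h2)
  have hg : ContDiffOn ℝ ∞ g U :=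
    (hN.inv fun u hu => normSq_ne_zero (h u hu)).smul (conjL.contDiff.comp_contDiffOn hf.contDiffOn)
  have hfg : ∀ u ∈ U, f u * g u = 1 := fun u hu => by
    simp only [g]
    rw [mul_smul_comm, mul_conj, smul_smul, inv_mul_cancel₀ (normSq_ne_zero (h u hu)), one_smul]
  refine ⟨g, ⟨hg, fun u hu w => ?_⟩, hfg⟩
  have hgd : DifferentiableAt ℝ g u := (hg.contDiffAt (hU.mem_nhds hu)).differentiableAt (by simp)
  have hz : ∀ w, f u * fderiv ℝ g u w + fderiv ℝ f u w * g u = 0 := fun w => by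
    rw [← fderiv_mul_apply (hf.differentiableAt hU hu) hgd]
    have : f * g =ᶠ[𝓝 u] fun _ => 1 := Filter.eventually_of_mem (hU.mem_nhds hu) hfg
    rw [this.fderiv_eq]
    simp
  have h1 := hz w
  have h2 := hz (e • w)
  rw [hf.fderiv_e_smul u hu] at h2
  linear_combination g u * h2 - e * g u * h1 + (e * fderiv ℝ g u w - fderiv ℝ g u (e • w)) * hfg u hu

theorem fderiv_fderiv_apply (hf : IsParaHolomorphicOn f U) (hU : IsOpen U) {u : ParaSpace n}
    (hu : u ∈ U) (v w : ParaSpace n) :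
    fderiv ℝ (fun x => fderiv ℝ f x v) u w = fderiv ℝ (fderiv ℝ f) u w v := by
  have h1 : DifferentiableAt ℝ (fderiv ℝ f) u :=
    ((hf.contDiffAt hU hu).fderiv_right (m := 1) (WithTop.coe_le_coe.mpr le_top)).differentiableAt
      (by simp)
  rw [fderiv_clm_apply h1 (differentiableAt_const v)]
  simp

theorem fderiv_symm (hf : IsParaHolomorphicOn f U) (hU : IsOpen U) {u : ParaSpace n}
    (hu : u ∈ U) (v w : ParaSpace n) :
    fderiv ℝ (fderiv ℝ f) u v w = fderiv ℝ (fderiv ℝ f) u w v :=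
  ((hf.contDiffAt hU hu).isSymmSndFDerivAt
    (by rw [minSmoothness_of_isRCLikeNormedField]; exact ENat.LEInfty.out)).eq v w

/-- Symmetry of the second derivative moves the factor `e` from the outer direction to the inner
one, where para-holomorphy of `f` applies. -/
theorem fderiv_apply (hf : IsParaHolomorphicOn f U) (hU : IsOpen U) (v : ParaSpace n) :
    IsParaHolomorphicOn (fun x => fderiv ℝ f x v) U where
  contDiffOn := (hf.contDiffOn.fderiv_of_isOpen hU (m := ∞) (by simp)).clm_apply contDiffOn_const
  fderiv_e_smul u hu w := by
    rw [hf.fderiv_fderiv_apply hU hu, hf.fderiv_fderiv_apply hU hu, hf.fderiv_symm hU hu,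
      hf.fderiv_symm hU hu w, ← hf.fderiv_fderiv_apply hU hu, ← hf.fderiv_fderiv_apply hU hu]
    have : (fun x => fderiv ℝ f x (e • w)) =ᶠ[𝓝 u] (fun _ => e) * fun x => fderiv ℝ f x w :=
      Filter.eventually_of_mem (hU.mem_nhds hu) fun x hx => hf.fderiv_e_smul x hx w
    have hd : DifferentiableAt ℝ (fun x => fderiv ℝ f x w) u :=
      (((hf.contDiffOn.fderiv_of_isOpen hU (m := ∞) (by simp)).clm_apply
        contDiffOn_const).contDiffAt (hU.mem_nhds hu)).differentiableAt (by simp)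
    rw [this.fderiv_eq, fderiv_mul_apply (differentiableAt_const e) hd]
    simp

theorem comp {V : Set (ParaSpace n)} {ψ : ParaSpace n → ParaSpace n}
    (hf : IsParaHolomorphicOn f V) (hU : IsOpen U) (hV : IsOpen V) (hψ : ContDiffOn ℝ ∞ ψ U)
    (hψe : ∀ u ∈ U, ∀ w, fderiv ℝ ψ u (e • w) = e • fderiv ℝ ψ u w) (hm : Set.MapsTo ψ U V) :
    IsParaHolomorphicOn (f ∘ ψ) U where
  contDiffOn := hf.contDiffOn.comp hψ hm
  fderiv_e_smul u hu w := by
    have hd : DifferentiableAt ℝ ψ u := (hψ.contDiffAt (hU.mem_nhds hu)).differentiableAt (by simp)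
    rw [fderiv_comp _ (hf.differentiableAt hV (hm hu)) hd]
    simp only [ContinuousLinearMap.comp_apply, hψe u hu, hf.fderiv_e_smul _ (hm hu)]

end IsParaHolomorphicOn

/-- The algebra of para-holomorphic functions on an open subset of `Cⁿ`. -/
def HolAlgebra (U : TopologicalSpace.Opens (ParaSpace n)) : Subalgebra ℝ (U → ParaComplex) where
  carrier := {f | ∃ F : ParaSpace n → ParaComplex, IsParaHolomorphicOn F U ∧ ∀ u : U, F u = f u}
  mul_mem' := by
    rintro f g ⟨F, hF, h⟩ ⟨F', hF', h'⟩
    exact ⟨F * F', hF.mul hF' U.isOpen, fun u => by simp [h, h']⟩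
  add_mem' := by
    rintro f g ⟨F, hF, h⟩ ⟨F', hF', h'⟩
    exact ⟨F + F', hF.add hF' U.isOpen, fun u => by simp [h, h']⟩
  algebraMap_mem' r := ⟨fun _ => algebraMap ℝ ParaComplex r, .const _, fun _ => rfl⟩

namespace HolAlgebra

variable {U V : TopologicalSpace.Opens (ParaSpace n)}

/-- The element of the algebra given by a para-holomorphic function. -/
def of (F : ParaSpace n → ParaComplex) (hF : IsParaHolomorphicOn F U) : HolAlgebra U :=
  ⟨fun u => F u, F, hF, fun _ => rfl⟩

/-- A function on `Cⁿ` that represents `f`. -/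
def rep (f : HolAlgebra U) : ParaSpace n → ParaComplex := f.2.choose

theorem isParaHolomorphicOn_rep (f : HolAlgebra U) : IsParaHolomorphicOn (rep f) U :=
  f.2.choose_spec.1

theorem rep_apply (f : HolAlgebra U) (u : U) : rep f u = f.1 u := f.2.choose_spec.2 u

/-- Elements of the algebra are functions on `U` only. Since `U` is open, derivatives at its points
do not depend on the extension, so any convenient representative may be used. -/
theorem fderiv_rep {f : HolAlgebra U} {F : ParaSpace n → ParaComplex} (h : ∀ u : U, F u = f.1 u)
    (u : U) : fderiv ℝ (rep f) u = fderiv ℝ F u :=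
  Filter.EventuallyEq.fderiv_eq <| Filter.eventually_of_mem (U.isOpen.mem_nhds u.2) fun v hv =>
    (rep_apply f ⟨v, hv⟩).trans (h ⟨v, hv⟩).symm

/-- Evaluation at a point. -/
def ev (u : U) : HolAlgebra U →+* ParaComplex :=
  (Pi.evalRingHom (fun _ : U => ParaComplex) u).comp (HolAlgebra U).val.toRingHom

theorem ev_apply (u : U) (f : HolAlgebra U) : ev u f = f.1 u := rfl

theorem ev_ext {f g : HolAlgebra U} (h : ∀ u, ev u f = ev u g) : f = g :=
  Subtype.ext (funext h)

theorem ev_smul (u : U) (r : ℝ) (f : HolAlgebra U) : ev u (r • f) = r • ev u f := rfl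

/-- The derivation `∂/∂zᵃ`. -/
def deriv (U : TopologicalSpace.Opens (ParaSpace n)) (a : Fin n) :
    Derivation ℝ (HolAlgebra U) (HolAlgebra U) where
  -- The derivative along the real direction xᵃ suffices, since it equals ∂/∂zᵃ on para-holomorphic
  -- functions.
  toFun f := of (fun u => fderiv ℝ (rep f) u (Pi.single a 1))
    ((isParaHolomorphicOn_rep f).fderiv_apply U.isOpen _)
  map_add' f g := ev_ext fun u => by
    have h : ∀ u : U, (rep f + rep g) u = (f + g).1 u := fun u => by
      simp [rep_apply]
    simp only [ev_apply, of, map_add, fderiv_rep h u]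
    rw [fderiv_add ((isParaHolomorphicOn_rep f).differentiableAt U.isOpen u.2)
      ((isParaHolomorphicOn_rep g).differentiableAt U.isOpen u.2)]
    rfl
  map_smul' r f := ev_ext fun u => by
    have h : ∀ u : U, (r • rep f) u = (r • f).1 u := fun u => by
      simp [rep_apply]
    simp only [ev_apply, of, fderiv_rep h u]
    rw [fderiv_const_smul ((isParaHolomorphicOn_rep f).differentiableAt U.isOpen u.2)]
    rfl
  map_one_eq_zero' := ev_ext fun u => by
    have h : ∀ u : U, (fun _ : ParaSpace n => (1 : ParaComplex)) u = (1 : HolAlgebra U).1 u :=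
      fun u => rfl
    change fderiv ℝ (rep (1 : HolAlgebra U)) u _ = 0
    rw [fderiv_rep (F := fun _ => 1) h u]
    simp
  leibniz' f g := ev_ext fun u => by
    have h : ∀ u : U, (rep f * rep g) u = (f * g).1 u := fun u => by
      simp [rep_apply]
    change fderiv ℝ (rep (f * g)) u _ = f.1 u * fderiv ℝ (rep g) u _ + g.1 u * fderiv ℝ (rep f) u _
    rw [fderiv_rep h u, IsParaHolomorphicOn.fderiv_mul_apply
      ((isParaHolomorphicOn_rep f).differentiableAt U.isOpen u.2)
      ((isParaHolomorphicOn_rep g).differentiableAt U.isOpen u.2), rep_apply, rep_apply]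
    ring

theorem ev_deriv {f : HolAlgebra U} {F : ParaSpace n → ParaComplex} (h : ∀ u : U, F u = ev u f)
    (a : Fin n) (u : U) : ev u (deriv U a f) = fderiv ℝ F u (Pi.single a 1) :=
  congrArg (· (Pi.single a 1)) (fderiv_rep h u)

theorem isParaHolomorphicOn_of_ev {f : HolAlgebra U} {F : ParaSpace n → ParaComplex}
    (h : ∀ u : U, F u = ev u f) : IsParaHolomorphicOn F U :=
  (isParaHolomorphicOn_rep f).congr U.isOpen fun u hu =>
    (h ⟨u, hu⟩).trans (rep_apply f ⟨u, hu⟩).symm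

theorem partialZ_eq_ev {f : HolAlgebra U} {F : ParaSpace n → ParaComplex} (h : ∀ u : U, F u = ev u f)
    (a : Fin n) (u : U) : partialZ a F u = ev u (deriv U a f) := by
  rw [ev_deriv h, partialZ_eq ((isParaHolomorphicOn_of_ev h).fderiv_e_smul u u.2)]

theorem deriv_comm (a b : Fin n) (f : HolAlgebra U) :
    deriv U a (deriv U b f) = deriv U b (deriv U a f) := ev_ext fun u => by
  have hf := isParaHolomorphicOn_rep f
  rw [ev_deriv (F := fun u => fderiv ℝ (rep f) u (Pi.single b 1)) (fun u => rfl),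
    ev_deriv (F := fun u => fderiv ℝ (rep f) u (Pi.single a 1)) (fun u => rfl),
    hf.fderiv_fderiv_apply U.isOpen u.2, hf.fderiv_fderiv_apply U.isOpen u.2,
    hf.fderiv_symm U.isOpen u.2]

theorem isUnit_of_ev {f : HolAlgebra U} (h : ∀ u, IsUnit (ev u f)) : IsUnit f := by
  obtain ⟨g, hg, hfg⟩ := (isParaHolomorphicOn_rep f).exists_inverse U.isOpen fun u hu => by
    rw [rep_apply f ⟨u, hu⟩]; exact h ⟨u, hu⟩
  refine IsUnit.of_mul_eq_one (of g hg) (ev_ext fun u => ?_)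
  have := hfg u u.2
  rw [rep_apply] at this
  exact this

theorem isUnit_det_of_ev {G : Matrix (Fin n) (Fin n) (HolAlgebra U)}
    (h : ∀ u, IsUnit (G.map (ev u)).det) : IsUnit G.det :=
  isUnit_of_ev fun u => by rw [RingHom.map_det]; exact h u

theorem ev_inv {G : Matrix (Fin n) (Fin n) (HolAlgebra U)} (h : IsUnit G.det) (u : U) :
    G⁻¹.map (ev u) = (G.map (ev u))⁻¹ := by
  refine (Matrix.inv_eq_right_inv ?_).symm
  rw [← Matrix.map_mul, Matrix.mul_nonsing_inv _ h]
  simp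

/-- A para-holomorphic map between open subsets of `Cⁿ`. -/
structure IsHolMap (ψ : ParaSpace n → ParaSpace n) (U V : TopologicalSpace.Opens (ParaSpace n)) :
    Prop where
  contDiffOn : ContDiffOn ℝ ∞ ψ U
  fderiv_e_smul : ∀ u ∈ U, ∀ w, fderiv ℝ ψ u (e • w) = e • fderiv ℝ ψ u w
  mapsTo : Set.MapsTo ψ U V

variable {ψ : ParaSpace n → ParaSpace n}

theorem IsHolMap.differentiableAt (hψ : IsHolMap ψ U V) (u : U) : DifferentiableAt ℝ ψ u :=
  (hψ.contDiffOn.contDiffAt (U.isOpen.mem_nhds u.2)).differentiableAt (by simp)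

theorem IsHolMap.fderiv_component (hψ : IsHolMap ψ U V) (i : Fin n) (u : U) (w : ParaSpace n) :
    fderiv ℝ (fun u => ψ u i) u w = fderiv ℝ ψ u w i :=
  congrArg (· w) (((hasFDerivAt_pi' (Φ := ψ)).mp (hψ.differentiableAt u).hasFDerivAt i).fderiv)

/-- The components of a para-holomorphic map. -/
def component (hψ : IsHolMap ψ U V) (i : Fin n) : HolAlgebra U :=
  of (fun u => ψ u i) ⟨contDiffOn_pi.mp hψ.contDiffOn i, fun u hu w => by
    rw [hψ.fderiv_component i ⟨u, hu⟩, hψ.fderiv_component i ⟨u, hu⟩, hψ.fderiv_e_smul u hu]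
    rfl⟩

/-- The Jacobian matrix of a para-holomorphic map. -/
def jacobian (hψ : IsHolMap ψ U V) : Matrix (Fin n) (Fin n) (HolAlgebra U) :=
  Matrix.of fun i a => deriv U a (component hψ i)

theorem ev_jacobian (hψ : IsHolMap ψ U V) (u : U) (i a : Fin n) :
    ev u (jacobian hψ i a) = fderiv ℝ ψ u (Pi.single a 1) i := by
  rw [← hψ.fderiv_component]
  exact ev_deriv (fun u => rfl) a u

/-- Pullback along a para-holomorphic map. -/
def pullback (hψ : IsHolMap ψ U V) : HolAlgebra V →+* HolAlgebra U where
  toFun f := ⟨fun u => f.1 ⟨ψ u, hψ.mapsTo u.2⟩, rep f ∘ ψ,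
    (isParaHolomorphicOn_rep f).comp U.isOpen V.isOpen hψ.contDiffOn hψ.fderiv_e_smul hψ.mapsTo,
    fun u => rep_apply f ⟨ψ u, hψ.mapsTo u.2⟩⟩
  map_one' := rfl
  map_zero' := rfl
  map_add' _ _ := rfl
  map_mul' _ _ := rfl

theorem ev_pullback (hψ : IsHolMap ψ U V) (u : U) (f : HolAlgebra V) :
    ev u (pullback hψ f) = ev ⟨ψ u, hψ.mapsTo u.2⟩ f := rfl

/-- The differential of `f` is C-linear, so the chain rule has no conjugate terms. -/
theorem deriv_pullback (hψ : IsHolMap ψ U V) (a : Fin n) (f : HolAlgebra V) :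
    deriv U a (pullback hψ f) = ∑ i, jacobian hψ i a * pullback hψ (deriv V i f) :=
  ev_ext fun u => by
    have hf := isParaHolomorphicOn_rep f
    have hu := hψ.mapsTo u.2
    rw [ev_deriv (f := pullback hψ f) (F := rep f ∘ ψ) (fun u => rep_apply f ⟨ψ u, hψ.mapsTo u.2⟩), map_sum,
      fderiv_comp _ (hf.differentiableAt V.isOpen hu) (hψ.differentiableAt u)]
    refine (eq_sum_of_map_e_smul (L := (fderiv ℝ (rep f) (ψ u)).toLinearMap)
      (hf.fderiv_e_smul _ hu) _).trans (Finset.sum_congr rfl fun i _ => ?_)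
    rw [map_mul, ev_jacobian]
    rfl

theorem deriv_jacobian (hψ : IsHolMap ψ U V) (a i c : Fin n) :
    deriv U a (jacobian hψ i c) = deriv U c (jacobian hψ i a) :=
  deriv_comm a c (component hψ i)

/-- By C-linearity the n para-complex partials determine all 2n real ones. -/
theorem fderiv_eq_zero_of_deriv {f : HolAlgebra U} {F : ParaSpace n → ParaComplex}
    (h : ∀ u : U, F u = ev u f) (hd : ∀ a, deriv U a f = 0) (u : U) : fderiv ℝ F u = 0 := by
  ext1 w
  refine (eq_sum_of_map_e_smul (L := (fderiv ℝ F u).toLinearMap)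
    ((isParaHolomorphicOn_of_ev h).fderiv_e_smul u u.2) w).trans ?_
  refine Finset.sum_eq_zero fun a _ => ?_
  have : fderiv ℝ F u (Pi.single a 1) = 0 := by rw [← ev_deriv h, hd, map_zero]
  simp [this]

end HolAlgebra

/-- A square matrix over `C` with trivial kernel is invertible. -/
theorem ParaComplex.isUnit_det {n : ℕ} {P : Matrix (Fin n) (Fin n) ParaComplex}
    (h : ∀ x, P.mulVec x = 0 → x = 0) : IsUnit P.det := by
  have key : ∀ (s : ℝ) (hs : s * s = 1), proj s hs P.det ≠ 0 := by
    intro s hs h0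
    have hs' : -s * -s = 1 := by rw [neg_mul_neg, hs]
    rw [RingHom.map_det] at h0
    obtain ⟨v, hv, hv0⟩ := Matrix.exists_mulVec_eq_zero_iff.mpr h0
    -- A real kernel vector in one factor, extended by zero in the other, is a kernel vector over C.
    choose x hx hx' using fun i => exists_proj hs hs' (v i) 0
    refine hv (funext fun i => ?_)
    have hx0 : x = 0 := h x <| funext fun i => ext_proj hs hs'
      (by
        have := congrFun hv0 i
        simp only [Matrix.mulVec, dotProduct, RingHom.mapMatrix_apply, Matrix.map_apply,
          Pi.zero_apply] at this ⊢
        refine Eq.trans ?_ (this.trans (map_zero (proj s hs)).symm)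
        rw [map_sum]
        exact Finset.sum_congr rfl fun j _ => by rw [map_mul, hx])
      (by
        simp only [Matrix.mulVec, dotProduct, Pi.zero_apply]
        rw [map_sum, map_zero]
        exact Finset.sum_eq_zero fun j _ => by rw [map_mul, hx', mul_zero])
    rw [← hx i, hx0]
    simp
  exact (isUnit_iff (s := 1) (by norm_num) (by norm_num)).mpr ⟨key _ _, key _ _⟩

/-! ### Para-holomorphic charts and the components of the metric -/

section Manifold

variable {n : ℕ} {M : Type*} [TopologicalSpace M] [ChartedSpace (ParaSpace n) M]

namespace ParaTangent

variable {p : M}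

theorem exists_eq_add (Z : ParaTangent n M p) :
    ∃ v w : TangentSpace 𝓘(ℝ, ParaSpace n) p, Z = (1 : ParaComplex) ⊗ₜ[ℝ] v + e ⊗ₜ[ℝ] w := by
  induction Z using TensorProduct.induction_on with
  | zero => exact ⟨0, 0, by simp⟩
  | tmul c v =>
    refine ⟨c.re • v, c.im • v, ?_⟩
    conv_lhs => rw [eq_smul_add c, TensorProduct.add_tmul, TensorProduct.smul_tmul,
      TensorProduct.smul_tmul]
  | add Z W hZ hW =>
    obtain ⟨v, w, rfl⟩ := hZ
    obtain ⟨v', w', rfl⟩ := hW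
    exact ⟨v + v', w + w', by rw [TensorProduct.tmul_add, TensorProduct.tmul_add]; abel⟩

/-- The real part of a para-complex tangent vector. -/
def rePart (p : M) : ParaTangent n M p →ₗ[ℝ] TangentSpace 𝓘(ℝ, ParaSpace n) p :=
  (TensorProduct.lid ℝ _).toLinearMap ∘ₗ
    TensorProduct.map (QuadraticAlgebra.reₗ 1 0) LinearMap.id

theorem rePart_tmul (c : ParaComplex) (v : TangentSpace 𝓘(ℝ, ParaSpace n) p) :
    rePart p (c ⊗ₜ[ℝ] v) = c.re • v := by
  simp [rePart]

theorem e_smul_tmul (c : ParaComplex) (v : TangentSpace 𝓘(ℝ, ParaSpace n) p) :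
    e • (c ⊗ₜ[ℝ] v : ParaTangent n M p) = (e * c) ⊗ₜ[ℝ] v := by
  rw [TensorProduct.smul_tmul', smul_eq_mul]

end ParaTangent

theorem dz_tmul (φ : OpenPartialHomeomorph M (ParaSpace n)) (p : M) (c : ParaComplex)
    (v : TangentSpace 𝓘(ℝ, ParaSpace n) p) :
    dz φ p (c ⊗ₜ[ℝ] v) = c • chartDeriv φ p v := by
  simp [dz]

section Charts

variable {φ : OpenPartialHomeomorph M (ParaSpace n)}

theorem chart_mdifferentiable (hφ : φ ∈ IsManifold.maximalAtlas 𝓘(ℝ, ParaSpace n) ∞ M) :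
    φ.MDifferentiable 𝓘(ℝ, ParaSpace n) 𝓘(ℝ, ParaSpace n) :=
  ⟨(contMDiffOn_of_mem_maximalAtlas hφ).mdifferentiableOn (by simp),
    (contMDiffOn_symm_of_mem_maximalAtlas hφ).mdifferentiableOn (by simp)⟩

theorem chartDeriv_injective (hφ : φ ∈ IsManifold.maximalAtlas 𝓘(ℝ, ParaSpace n) ∞ M) {p : M}
    (hp : p ∈ φ.source) : Function.Injective (chartDeriv φ p) :=
  (chart_mdifferentiable hφ).mfderiv_injective hp

theorem chartDeriv_coordVector (hφ : φ ∈ IsManifold.maximalAtlas 𝓘(ℝ, ParaSpace n) ∞ M)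
    {u : ParaSpace n} (hu : u ∈ φ.target) (w : ParaSpace n) :
    chartDeriv φ (φ.symm u) (coordVector φ w u) = w :=
  congrArg (· w) ((chart_mdifferentiable hφ).comp_symm_deriv hu)

/-- The coordinate vector field in the direction `w`, as a vector field on the source of `φ`. -/
def coordField (φ : OpenPartialHomeomorph M (ParaSpace n)) (w : ParaSpace n) (q : M) :
    TangentSpace 𝓘(ℝ, ParaSpace n) q :=
  (coordVector φ w (φ q) : ParaSpace n)

theorem coordField_symm {u : ParaSpace n} (hu : u ∈ φ.target) (w : ParaSpace n) :
    coordField φ w (φ.symm u) = coordVector φ w u := by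
  have h : ∀ u' u : ParaSpace n, u' = u →
      (coordVector φ w u' : ParaSpace n) = (coordVector φ w u : ParaSpace n) := by
    rintro _ _ rfl; rfl
  exact h _ _ (φ.right_inv hu)

/-- Smoothness of the metric is formulated on real vector fields of `M`, so coordinate fields are
needed as such: this one is the tangent map of `φ.symm` applied to a constant field. -/
theorem contMDiffAt_coordField [IsManifold 𝓘(ℝ, ParaSpace n) ∞ M]
    (hφ : φ ∈ IsManifold.maximalAtlas 𝓘(ℝ, ParaSpace n) ∞ M)
    (w : ParaSpace n) {p : M} (hp : p ∈ φ.source) :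
    ContMDiffAt 𝓘(ℝ, ParaSpace n) 𝓘(ℝ, ParaSpace n).tangent ∞
      (fun q => (⟨q, coordField φ w q⟩ : TangentBundle 𝓘(ℝ, ParaSpace n) M)) p := by
  have h1 := (contMDiffOn_symm_of_mem_maximalAtlas hφ).contMDiffOn_tangentMapWithin
    (m := ∞) (by simp) φ.open_target.uniqueMDiffOn
  have h2 : ContMDiffAt 𝓘(ℝ, ParaSpace n) 𝓘(ℝ, ParaSpace n).tangent ∞
      (fun u => (⟨u, w⟩ : TangentBundle 𝓘(ℝ, ParaSpace n) (ParaSpace n))) (φ p) :=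
    contMDiffAt_vectorSpace_iff_contDiffAt.mpr contDiffAt_const
  have h3 := h2.comp p (contMDiffAt_of_mem_maximalAtlas hφ hp)
  have h4 := h1.contMDiffAt (x := (⟨φ p, w⟩ : TangentBundle 𝓘(ℝ, ParaSpace n) (ParaSpace n)))
    ((φ.open_target.preimage (FiberBundle.continuous_proj (ParaSpace n) _)).mem_nhds
      (φ.map_source hp))
  refine (h4.comp p h3).congr_of_eventuallyEq ?_
  filter_upwards [φ.open_source.mem_nhds hp] with q hq
  obtain ⟨u, hu, rfl⟩ : ∃ u ∈ φ.target, φ.symm u = q := ⟨φ q, φ.map_source hq, φ.left_inv hq⟩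
  have h5 : ∀ u', u' = u → (⟨φ.symm u, coordVector φ w u⟩ : TangentBundle 𝓘(ℝ, ParaSpace n) M) =
      tangentMapWithin 𝓘(ℝ, ParaSpace n) 𝓘(ℝ, ParaSpace n) φ.symm φ.target ⟨u', w⟩ := by
    rintro _ rfl
    rw [tangentMapWithin, mfderivWithin_of_isOpen φ.open_target hu]
    rfl
  rw [coordField_symm hu]
  exact h5 _ (φ.right_inv hu)

end Charts

variable [IsManifold 𝓘(ℝ, ParaSpace n) ∞ M]

variable {J : ParaComplexStructure n M}

namespace ParaComplexStructure

variable {p : M}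

/-- Comparing real parts in I Z = e Z for Z = v + e w gives w = I v. -/
theorem mem_T10_iff (J : ParaComplexStructure n M) {Z : ParaTangent n M p} :
    Z ∈ J.T10 p ↔ ∃ v, Z = (1 : ParaComplex) ⊗ₜ[ℝ] v + e ⊗ₜ[ℝ] J.I p v := by
  have hext : ∀ (c : ParaComplex) (v : TangentSpace 𝓘(ℝ, ParaSpace n) p),
      J.extend p (c ⊗ₜ[ℝ] v) = c ⊗ₜ[ℝ] J.I p v := fun c v => by simp [extend]
  rw [T10, Module.End.mem_eigenspace_iff]
  constructor
  · intro h
    obtain ⟨v, w, rfl⟩ := ParaTangent.exists_eq_add Z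
    refine ⟨v, ?_⟩
    rw [map_add, hext, hext, smul_add, ParaTangent.e_smul_tmul, ParaTangent.e_smul_tmul, e_mul_e,
      mul_one] at h
    have h1 := congrArg (ParaTangent.rePart p) h
    simp only [map_add, ParaTangent.rePart_tmul, QuadraticAlgebra.re_one, one_smul] at h1
    simp only [e, zero_smul, add_zero, zero_add] at h1
    rw [h1]
  · rintro ⟨v, rfl⟩
    rw [map_add, hext, hext, smul_add, ParaTangent.e_smul_tmul, ParaTangent.e_smul_tmul, e_mul_e,
      mul_one, J.sq, add_comm]

/-- The projectors onto the two summands are (1 ± eI)/2, since (eI)² = 1. -/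
theorem exists_T10_add_T01 (J : ParaComplexStructure n M) (W : ParaTangent n M p) :
    ∃ W₁ ∈ J.T10 p, ∃ W₂ ∈ J.T01 p, W = W₁ + W₂ := by
  have hsq : J.extend p (J.extend p W) = W := by
    obtain ⟨v, w, rfl⟩ := ParaTangent.exists_eq_add W
    simp [extend, J.sq]
  have h2 : ((2⁻¹ : ℝ) • (W + e • J.extend p W) + (2⁻¹ : ℝ) • (W - e • J.extend p W)) = W := by
    rw [← smul_add, add_add_sub_cancel, ← two_smul ℝ W, smul_smul]
    norm_num
  refine ⟨_, ?_, _, ?_, h2.symm⟩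
  · rw [T10, Module.End.mem_eigenspace_iff, LinearMap.map_smul_of_tower, map_add, map_smul, hsq,
      smul_comm e, smul_add e, smul_smul e e, e_mul_e, one_smul, add_comm]
  · rw [T01, Module.End.mem_eigenspace_iff, LinearMap.map_smul_of_tower, map_sub, map_smul, hsq,
      smul_comm (-e), neg_smul, smul_sub e, smul_smul e e, e_mul_e, one_smul, neg_sub]

namespace IsParaHolomorphicChart

variable {φ : OpenPartialHomeomorph M (ParaSpace n)}

/-- On Z = v + e I v the map `dz` takes the value dφ(v) + e² dφ(v) = 2 dφ(v), and dφ is injective.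
-/
theorem dz_eq_zero (hφ : J.IsParaHolomorphicChart φ) (hp : p ∈ φ.source) {Z : ParaTangent n M p}
    (hZ : Z ∈ J.T10 p) (h : dz φ p Z = 0) : Z = 0 := by
  obtain ⟨v, rfl⟩ := J.mem_T10_iff.mp hZ
  rw [map_add, dz_tmul, dz_tmul, hφ.chartDeriv_I p hp, smul_smul, e_mul_e, one_smul,
    ← two_smul ℝ, smul_eq_zero] at h
  have hv : v = 0 := chartDeriv_injective hφ.mem_maximalAtlas hp
    ((h.resolve_left (by norm_num)).trans (map_zero _).symm)
  simp [hv]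

theorem coordVector_e (hφ : J.IsParaHolomorphicChart φ) {u : ParaSpace n} (hu : u ∈ φ.target)
    (w : ParaSpace n) : coordVector φ (e • w) u = J.I _ (coordVector φ w u) := by
  apply chartDeriv_injective hφ.mem_maximalAtlas (φ.map_target hu)
  rw [hφ.chartDeriv_I _ (φ.map_target hu), chartDeriv_coordVector hφ.mem_maximalAtlas hu,
    chartDeriv_coordVector hφ.mem_maximalAtlas hu]

theorem coordZ_eq (hφ : J.IsParaHolomorphicChart φ) {u : ParaSpace n} (hu : u ∈ φ.target)
    (a : Fin n) : coordZ φ a u =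
      (1 : ParaComplex) ⊗ₜ[ℝ] ((2⁻¹ : ℝ) • coordVector φ (Pi.single a 1) u) +
      e ⊗ₜ[ℝ] J.I _ ((2⁻¹ : ℝ) • coordVector φ (Pi.single a 1) u) := by
  have h1 : (Pi.single a e : ParaSpace n) = e • (Pi.single a 1 : ParaSpace n) := by
    rw [← Pi.single_smul, smul_eq_mul, mul_one]
  rw [coordZ, h1, hφ.coordVector_e hu, ParaTangent.ofReal, ParaTangent.ofReal,
    ParaTangent.e_smul_tmul, mul_one, map_smul, TensorProduct.tmul_smul, TensorProduct.tmul_smul,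
    smul_add]

theorem coordZ_mem (hφ : J.IsParaHolomorphicChart φ) {u : ParaSpace n} (hu : u ∈ φ.target)
    (a : Fin n) : coordZ φ a u ∈ J.T10 (φ.symm u) :=
  J.mem_T10_iff.mpr ⟨_, hφ.coordZ_eq hu a⟩

theorem dz_coordZ (hφ : J.IsParaHolomorphicChart φ) {u : ParaSpace n} (hu : u ∈ φ.target)
    (a : Fin n) : dz φ (φ.symm u) (coordZ φ a u) = Pi.single a 1 := by
  rw [hφ.coordZ_eq hu, map_add, dz_tmul, dz_tmul, hφ.chartDeriv_I _ (φ.map_target hu), smul_smul,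
    e_mul_e, one_smul, ← two_smul ℝ, map_smul, smul_smul,
    chartDeriv_coordVector hφ.mem_maximalAtlas hu]
  norm_num

theorem eq_sum_coordZ (hφ : J.IsParaHolomorphicChart φ) {u : ParaSpace n} (hu : u ∈ φ.target)
    {Z : ParaTangent n M (φ.symm u)} (hZ : Z ∈ J.T10 (φ.symm u)) :
    Z = ∑ a, dz φ (φ.symm u) Z a • coordZ φ a u := by
  have hsum : ∑ a, dz φ (φ.symm u) Z a • coordZ φ a u ∈ J.T10 (φ.symm u) :=
    Submodule.sum_mem _ fun a _ => Submodule.smul_mem _ _ (hφ.coordZ_mem hu a)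
  rw [← sub_eq_zero]
  refine hφ.dz_eq_zero (φ.map_target hu) (Submodule.sub_mem _ hZ hsum) ?_
  rw [map_sub, sub_eq_zero, map_sum]
  funext b
  simp [map_smul, hφ.dz_coordZ hu, Finset.sum_apply, Pi.single_apply]

theorem exists_dz_eq (hφ : J.IsParaHolomorphicChart φ) (hp : p ∈ φ.source) (z : ParaSpace n) :
    ∃ Z ∈ J.T10 p, dz φ p Z = z := by
  obtain ⟨u, hu, rfl⟩ : ∃ u ∈ φ.target, φ.symm u = p := ⟨φ p, φ.map_source hp, φ.left_inv hp⟩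
  refine ⟨∑ a, z a • coordZ φ a u,
    Submodule.sum_mem _ fun a _ => Submodule.smul_mem _ _ (hφ.coordZ_mem hu a), ?_⟩
  funext b
  simp [map_smul, hφ.dz_coordZ hu, Finset.sum_apply, Pi.single_apply]

end IsParaHolomorphicChart

end ParaComplexStructure

namespace ParaComplexMetric

variable (g : ParaComplexMetric J) {φ : OpenPartialHomeomorph M (ParaSpace n)}

theorem comp_isSymm (φ : OpenPartialHomeomorph M (ParaSpace n)) (u : ParaSpace n) :
    (g.comp φ u).IsSymm :=
  Matrix.IsSymm.ext fun _ _ => g.symm _ _ _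

theorem apply_eq_sum (hφ : J.IsParaHolomorphicChart φ) {p : M} (hp : p ∈ φ.source)
    {Z W : ParaTangent n M p} (hZ : Z ∈ J.T10 p) (hW : W ∈ J.T10 p) :
    g.G p Z W = ∑ a, ∑ b, g.comp φ (φ p) a b * dz φ p Z a * dz φ p W b := by
  obtain ⟨u, hu, rfl⟩ : ∃ u ∈ φ.target, φ.symm u = p := ⟨φ p, φ.map_source hp, φ.left_inv hp⟩
  conv_lhs => rw [hφ.eq_sum_coordZ hu hZ, hφ.eq_sum_coordZ hu hW]
  rw [φ.right_inv hu]
  simp only [map_sum, LinearMap.sum_apply, map_smul, LinearMap.smul_apply, smul_eq_mul, comp,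
    Matrix.of_apply]
  rw [Finset.sum_comm]
  refine Finset.sum_congr rfl fun a _ => ?_
  rw [Finset.mul_sum]
  exact Finset.sum_congr rfl fun b _ => by ring

/-- Since T^{1,0} is orthogonal to T^{0,1} and the two together span, a vector of T^{1,0} orthogonal
to T^{1,0} is orthogonal to everything. Hence nondegeneracy passes to the block G_ab. -/
theorem isUnit_det_comp (hφ : J.IsParaHolomorphicChart φ) {u : ParaSpace n} (hu : u ∈ φ.target) :
    IsUnit (g.comp φ u).det := by
  refine ParaComplex.isUnit_det fun x hx => ?_
  have hp := φ.map_target hu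
  obtain ⟨Z, hZ, rfl⟩ := hφ.exists_dz_eq hp x
  have hZ0 : Z = 0 := by
    refine (g.nondegenerate _).2 Z fun W => ?_
    obtain ⟨W₁, h1, W₂, h2, rfl⟩ := J.exists_T10_add_T01 W
    rw [map_add, LinearMap.add_apply, g.symm _ W₂, g.orthogonal _ _ hZ _ h2, add_zero,
      g.apply_eq_sum hφ hp h1 hZ, φ.right_inv hu]
    refine Finset.sum_eq_zero fun a _ => ?_
    have ha := congrFun hx a
    simp only [Matrix.mulVec, dotProduct, Pi.zero_apply] at ha
    calc _ = dz φ _ W₁ a * ∑ b, g.comp φ u a b * dz φ _ Z b := by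
          rw [Finset.mul_sum]; exact Finset.sum_congr rfl fun b _ => by ring
      _ = 0 := by rw [ha, mul_zero]
  rw [hZ0, map_zero]

theorem contDiffOn_coordVector (hφ : φ ∈ IsManifold.maximalAtlas 𝓘(ℝ, ParaSpace n) ∞ M)
    (w w' : ParaSpace n) : ContDiffOn ℝ ∞ (fun u => g.G (φ.symm u)
      (ParaTangent.ofReal (coordVector φ w u)) (ParaTangent.ofReal (coordVector φ w' u)))
      φ.target := by
  intro u hu
  have h := g.smooth _ _ (φ.symm u) (contMDiffAt_coordField hφ w (φ.map_target hu))
    (contMDiffAt_coordField hφ w' (φ.map_target hu))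
  have h2 := (h.comp u (contMDiffAt_symm_of_mem_maximalAtlas hφ hu)).contDiffAt
  refine ContDiffAt.contDiffWithinAt (h2.congr_of_eventuallyEq ?_)
  filter_upwards [φ.open_target.mem_nhds hu] with v hv
  simp only [Function.comp_apply, coordField_symm hv]

theorem contDiffOn_comp (hφ : φ ∈ IsManifold.maximalAtlas 𝓘(ℝ, ParaSpace n) ∞ M) (a b : Fin n) :
    ContDiffOn ℝ ∞ (fun u => g.comp φ u a b) φ.target := by
  have h := g.contDiffOn_coordVector hφ
  have he : ∀ {f : ParaSpace n → ParaComplex}, ContDiffOn ℝ ∞ f φ.target →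
      ContDiffOn ℝ ∞ (fun u => e * f u) φ.target := fun hf => (mulL e).contDiff.comp_contDiffOn hf
  have h1 := (((h (Pi.single a 1) (Pi.single b 1)).add
    (he (h (Pi.single a 1) (Pi.single b e)))).add ((he (h (Pi.single a e) (Pi.single b 1))).add
    (h (Pi.single a e) (Pi.single b e)))).const_smul ((2⁻¹ : ℝ) * 2⁻¹)
  refine h1.congr fun u _ => ?_
  simp only [comp, coordZ, Matrix.of_apply, LinearMap.map_smul_of_tower, map_add, map_smul,
    LinearMap.smul_apply, LinearMap.add_apply, smul_eq_mul]
  simp only [mul_smul_comm, mul_add, ← mul_assoc, e_mul_e, one_mul, smul_add, smul_smul, add_assoc]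

theorem isParaHolomorphicOn_comp (hg : g.IsParaHolomorphic) (hφ : J.IsParaHolomorphicChart φ)
    (a b : Fin n) : IsParaHolomorphicOn (fun u => g.comp φ u a b) φ.target where
  contDiffOn := g.contDiffOn_comp hφ.mem_maximalAtlas a b
  fderiv_e_smul u hu := fderiv_e_smul_of_partialZBar fun c => hg φ hφ u hu a b c

end ParaComplexMetric
end Manifold

/-! ### Transition maps and independence of the curvature from the chart -/

section QuadForm

variable {n : ℕ} {A : Type*} [CommRing A]

theorem quadForm_eq_sum_prod (S : Fin n → Fin n → Fin n → Fin n → A) (x y z w : Fin n → A) :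
    quadForm S x y z w = ∑ q : Fin n × Fin n × Fin n × Fin n,
      S q.1 q.2.1 q.2.2.1 q.2.2.2 * (x q.1 * (y q.2.1 * (z q.2.2.1 * w q.2.2.2))) := by
  simp only [Fintype.sum_prod_type, quadForm, mul_assoc]

/-- The quadrilinear form of a pulled back tensor. -/
theorem quadForm_pullback {S S' : Fin n → Fin n → Fin n → Fin n → A} (P : Matrix (Fin n) (Fin n) A)
    (h : ∀ a b c d, S a b c d =
      ∑ i, ∑ j, ∑ k, ∑ l, S' i j k l * (P i a * (P j b * (P k c * P l d))))
    (x y z w : Fin n → A) :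
    quadForm S x y z w = quadForm S' (P.mulVec x) (P.mulVec y) (P.mulVec z) (P.mulVec w) := by
  have h4 : ∀ f₁ f₂ f₃ f₄ : Fin n → A, (∑ a, f₁ a) * ((∑ b, f₂ b) * ((∑ c, f₃ c) * ∑ d, f₄ d)) =
      ∑ q : Fin n × Fin n × Fin n × Fin n, f₁ q.1 * (f₂ q.2.1 * (f₃ q.2.2.1 * f₄ q.2.2.2)) := by
    intro f₁ f₂ f₃ f₄
    simp only [Fintype.sum_prod_type, Finset.sum_mul_sum]
    simp only [Finset.mul_sum]
  rw [quadForm_eq_sum_prod, quadForm_eq_sum_prod]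
  simp only [Matrix.mulVec, dotProduct, h4]
  simp only [Finset.mul_sum]
  rw [Finset.sum_comm]
  refine Finset.sum_congr rfl fun q _ => ?_
  rw [h]
  simp only [Fintype.sum_prod_type, Finset.sum_mul]
  refine Finset.sum_congr rfl fun i _ => Finset.sum_congr rfl fun j _ =>
    Finset.sum_congr rfl fun k _ => Finset.sum_congr rfl fun l _ => by ring

end QuadForm

theorem IsParaHolomorphicOn.mono {n : ℕ} {f : ParaSpace n → ParaComplex} {U V : Set (ParaSpace n)}
    (hf : IsParaHolomorphicOn f V) (h : U ⊆ V) : IsParaHolomorphicOn f U :=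
  ⟨hf.contDiffOn.mono h, fun u hu => hf.fderiv_e_smul u (h hu)⟩

section Transition

variable {n : ℕ} {M : Type*} [TopologicalSpace M]

/-- The domain of the transition map between two charts. -/
def transitionDomain (φ φ' : OpenPartialHomeomorph M (ParaSpace n)) :
    TopologicalSpace.Opens (ParaSpace n) :=
  ⟨(φ.symm.trans φ').source, (φ.symm.trans φ').open_source⟩

/-- The target of a chart, as an open set. -/
def chartTarget (φ : OpenPartialHomeomorph M (ParaSpace n)) :
    TopologicalSpace.Opens (ParaSpace n) :=
  ⟨φ.target, φ.open_target⟩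

theorem mem_transitionDomain {φ φ' : OpenPartialHomeomorph M (ParaSpace n)}
    {u : ParaSpace n} :
    u ∈ transitionDomain φ φ' ↔ u ∈ φ.target ∧ φ.symm u ∈ φ'.source := by
  change u ∈ (φ.symm.trans φ').source ↔ _
  simp

theorem transitionDomain_subset (φ φ' : OpenPartialHomeomorph M (ParaSpace n)) :
    (transitionDomain φ φ' : Set (ParaSpace n)) ⊆ φ.target :=
  fun _ hu => (mem_transitionDomain.mp hu).1

theorem fderiv_transition [ChartedSpace (ParaSpace n) M]
    {φ φ' : OpenPartialHomeomorph M (ParaSpace n)}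
    (hφ : φ ∈ IsManifold.maximalAtlas 𝓘(ℝ, ParaSpace n) ∞ M)
    (hφ' : φ' ∈ IsManifold.maximalAtlas 𝓘(ℝ, ParaSpace n) ∞ M) {u : ParaSpace n}
    (hu : u ∈ transitionDomain φ φ') (w : ParaSpace n) :
    fderiv ℝ (φ' ∘ φ.symm) u w = chartDeriv φ' (φ.symm u) (coordVector φ w u) := by
  have hu' := mem_transitionDomain.mp hu
  have h := mfderiv_comp u ((chart_mdifferentiable hφ').mdifferentiableAt hu'.2)
    ((chart_mdifferentiable hφ).mdifferentiableAt_symm hu'.1)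
  rw [mfderiv_eq_fderiv] at h
  exact congrArg (· w) h

end Transition

section Manifold

variable {n : ℕ} {M : Type*} [TopologicalSpace M] [ChartedSpace (ParaSpace n) M]
variable [IsManifold 𝓘(ℝ, ParaSpace n) ∞ M] {J : ParaComplexStructure n M}
  {φ φ' : OpenPartialHomeomorph M (ParaSpace n)}

namespace ParaComplexMetric

variable {g : ParaComplexMetric J} {U : TopologicalSpace.Opens (ParaSpace n)}

/-- The matrix of components of the metric, over the algebra of para-holomorphic functions. -/
def holMatrix (hg : g.IsParaHolomorphic) (hφ : J.IsParaHolomorphicChart φ)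
    (hU : (U : Set (ParaSpace n)) ⊆ φ.target) : Matrix (Fin n) (Fin n) (HolAlgebra U) :=
  Matrix.of fun a b => HolAlgebra.of _ ((g.isParaHolomorphicOn_comp hg hφ a b).mono hU)

variable (hg : g.IsParaHolomorphic) (hφ : J.IsParaHolomorphicChart φ)
  (hU : (U : Set (ParaSpace n)) ⊆ φ.target)

theorem ev_holMatrix (u : U) (a b : Fin n) :
    HolAlgebra.ev u (holMatrix hg hφ hU a b) = g.comp φ u a b := rfl

theorem map_ev_holMatrix (u : U) : (holMatrix hg hφ hU).map (HolAlgebra.ev u) = g.comp φ u := rfl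

theorem holMatrix_isSymm : (holMatrix hg hφ hU).IsSymm :=
  Matrix.IsSymm.ext fun i j => HolAlgebra.ev_ext fun u => (g.comp_isSymm φ u).apply i j

theorem isUnit_det_holMatrix : IsUnit (holMatrix hg hφ hU).det :=
  HolAlgebra.isUnit_det_of_ev fun u => g.isUnit_det_comp hφ (hU u.2)

/-- The bridge from the coordinate formulas of the statement to the formal ones: evaluation commutes
with matrix inversion, and `partialZ` agrees with the derivation on para-holomorphic components. -/
theorem ev_christoffel (u : U) (c a b : Fin n) :
    g.christoffel φ c a b u = HolAlgebra.ev u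
      (FormalGeometry.christoffel (HolAlgebra.deriv U) (holMatrix hg hφ hU) c a b) := by
  have hinv : ∀ d, (g.comp φ u)⁻¹ c d = HolAlgebra.ev u ((holMatrix hg hφ hU)⁻¹ c d) := fun d => by
    rw [← map_ev_holMatrix hg hφ hU, ← HolAlgebra.ev_inv (isUnit_det_holMatrix hg hφ hU)]
    rfl
  have hd : ∀ a b d, partialZ a (fun v => g.comp φ v b d) u =
      HolAlgebra.ev u (HolAlgebra.deriv U a (holMatrix hg hφ hU b d)) := fun a b d =>
    HolAlgebra.partialZ_eq_ev (fun u => (ev_holMatrix hg hφ hU u b d).symm) a u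
  rw [christoffel, FormalGeometry.christoffel, HolAlgebra.ev_smul, map_sum]
  congr 1
  refine Finset.sum_congr rfl fun d _ => ?_
  rw [hinv, hd, hd, hd, map_mul, map_sub, map_add]

/-- With (Γ_a)ᵈ_c = Lᵈ_ca, the component Rᵈ_{c,ab} is the entry in row `d`, column `c` of the
curvature matrix, whose commutator gives the quadratic terms. -/
theorem ev_curvatureComp (u : U) (d c a b : Fin n) :
    g.curvatureComp φ d c a b u = HolAlgebra.ev u (FormalGeometry.curv (HolAlgebra.deriv U)
      (FormalGeometry.conn (HolAlgebra.deriv U) (holMatrix hg hφ hU)) a b d c) := by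
  have hd : ∀ a b c d, partialZ a (g.christoffel φ d b c) u = HolAlgebra.ev u (HolAlgebra.deriv U a
      (FormalGeometry.christoffel (HolAlgebra.deriv U) (holMatrix hg hφ hU) d b c)) :=
    fun a b c d => HolAlgebra.partialZ_eq_ev (fun u => ev_christoffel hg hφ hU u d b c) a u
  simp only [curvatureComp, hd, FormalGeometry.curv, Matrix.add_apply, Matrix.sub_apply,
    Matrix.mul_apply, Matrix.map_apply, map_add, map_sub, map_sum, map_mul, FormalGeometry.conn,
    Matrix.of_apply, ev_christoffel hg hφ hU, Finset.sum_sub_distrib]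
  congr 2
  · exact Finset.sum_congr rfl fun f _ => mul_comm _ _
  · exact Finset.sum_congr rfl fun f _ => mul_comm _ _

/-- The components `R_abcd = G_df Rᶠ_{c,ab}` of the curvature tensor. -/
def lowered (g : ParaComplexMetric J) (φ : OpenPartialHomeomorph M (ParaSpace n)) (u : ParaSpace n)
    (a b c d : Fin n) : ParaComplex :=
  ∑ f, g.comp φ u d f * g.curvatureComp φ f c a b u

theorem curvatureIn_eq_quadForm (p : M) (Z₁ Z₂ Z₃ Z₄ : ParaTangent n M p) :
    g.curvatureIn φ p Z₁ Z₂ Z₃ Z₄ =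
      quadForm (g.lowered φ (φ p)) (dz φ p Z₁) (dz φ p Z₂) (dz φ p Z₃) (dz φ p Z₄) := rfl

theorem ev_lowered (u : U) (a b c d : Fin n) :
    g.lowered φ u a b c d = HolAlgebra.ev u ((holMatrix hg hφ hU *
      FormalGeometry.curv (HolAlgebra.deriv U)
        (FormalGeometry.conn (HolAlgebra.deriv U) (holMatrix hg hφ hU)) a b) d c) := by
  rw [Matrix.mul_apply, map_sum]
  refine Finset.sum_congr rfl fun f _ => ?_
  rw [map_mul, ev_holMatrix, ev_curvatureComp hg hφ hU]

end ParaComplexMetric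

namespace ParaComplexStructure.IsParaHolomorphicChart

theorem isHolMap_transition (hφ : J.IsParaHolomorphicChart φ) (hφ' : J.IsParaHolomorphicChart φ') :
    HolAlgebra.IsHolMap (φ' ∘ φ.symm) (transitionDomain φ φ') (chartTarget φ') where
  contDiffOn := by
    have h := ((contMDiffOn_of_mem_maximalAtlas hφ'.mem_maximalAtlas).comp
      ((contMDiffOn_symm_of_mem_maximalAtlas hφ.mem_maximalAtlas).mono
        (transitionDomain_subset φ φ'))
      fun u hu => (mem_transitionDomain.mp hu).2)
    exact h.contDiffOn
  fderiv_e_smul u hu w := by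
    have hu' := mem_transitionDomain.mp hu
    rw [fderiv_transition hφ.mem_maximalAtlas hφ'.mem_maximalAtlas hu,
      fderiv_transition hφ.mem_maximalAtlas hφ'.mem_maximalAtlas hu, hφ.coordVector_e hu'.1,
      hφ'.chartDeriv_I _ hu'.2]
  mapsTo u hu := φ'.map_source (mem_transitionDomain.mp hu).2

variable (hφ : J.IsParaHolomorphicChart φ) (hφ' : J.IsParaHolomorphicChart φ')

/-- The Jacobian matrix of the transition map at a point. -/
def jacobianAt (u : transitionDomain φ φ') : Matrix (Fin n) (Fin n) ParaComplex :=
  (HolAlgebra.jacobian (hφ.isHolMap_transition hφ')).map (HolAlgebra.ev u)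

theorem dz_transition (u : transitionDomain φ φ') (Z : ParaTangent n M (φ.symm u)) :
    dz φ' (φ.symm u) Z = (hφ.jacobianAt hφ' u).mulVec (dz φ (φ.symm u) Z) := by
  have hu' := mem_transitionDomain.mp u.2
  obtain ⟨v, w, rfl⟩ := ParaTangent.exists_eq_add Z
  have hv : ∀ v : TangentSpace 𝓘(ℝ, ParaSpace n) (φ.symm u),
      chartDeriv φ' (φ.symm u) v = (hφ.jacobianAt hφ' u).mulVec (chartDeriv φ (φ.symm u) v) := by
    intro v
    have h1 : v = coordVector φ (chartDeriv φ (φ.symm u) v) u :=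
      chartDeriv_injective hφ.mem_maximalAtlas (φ.map_target hu'.1)
        (chartDeriv_coordVector hφ.mem_maximalAtlas hu'.1 _).symm
    conv_lhs => rw [h1, ← fderiv_transition hφ.mem_maximalAtlas hφ'.mem_maximalAtlas u.2]
    funext i
    rw [← (hφ.isHolMap_transition hφ').fderiv_component]
    refine (eq_sum_of_map_e_smul
      (L := (fderiv ℝ (fun v => (φ' ∘ φ.symm) v i) (u : ParaSpace n)).toLinearMap)
      (fun w => ?_) _).trans ?_
    · exact (HolAlgebra.isParaHolomorphicOn_of_ev
        (f := HolAlgebra.component (hφ.isHolMap_transition hφ') i) (fun _ => rfl)).fderiv_e_smul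
        u u.2 w
    · refine Finset.sum_congr rfl fun a _ => ?_
      rw [mul_comm]
      exact congrArg (· * _) (((hφ.isHolMap_transition hφ').fderiv_component i u _).trans
        (HolAlgebra.ev_jacobian (hφ.isHolMap_transition hφ') u i a).symm)
  rw [map_add, map_add, dz_tmul, dz_tmul, dz_tmul, dz_tmul, hv, hv, Matrix.mulVec_add,
    Matrix.mulVec_smul, Matrix.mulVec_smul]

/-- A kernel vector is `dz` of some Z in T^{1,0}; its components in the second chart vanish, and
`dz` is injective on T^{1,0} there too. -/
theorem isUnit_det_jacobian :
    IsUnit (HolAlgebra.jacobian (hφ.isHolMap_transition hφ')).det := by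
  refine HolAlgebra.isUnit_det_of_ev fun u => ParaComplex.isUnit_det fun x hx => ?_
  have hu' := mem_transitionDomain.mp u.2
  obtain ⟨Z, hZ, rfl⟩ := hφ.exists_dz_eq (φ.map_target hu'.1) x
  have h0 : dz φ' (φ.symm u) Z = 0 := (hφ.dz_transition hφ' u Z).trans hx
  rw [hφ'.dz_eq_zero hu'.2 hZ h0, map_zero]

end ParaComplexStructure.IsParaHolomorphicChart

namespace ParaComplexMetric

variable {g : ParaComplexMetric J} (hg : g.IsParaHolomorphic)
  (hφ : J.IsParaHolomorphicChart φ) (hφ' : J.IsParaHolomorphicChart φ')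

theorem holMatrix_transition :
    holMatrix hg hφ (transitionDomain_subset φ φ') =
      (HolAlgebra.jacobian (hφ.isHolMap_transition hφ'))ᵀ *
        (holMatrix hg hφ' (U := chartTarget φ') subset_rfl).map
          (HolAlgebra.pullback (hφ.isHolMap_transition hφ')) *
        HolAlgebra.jacobian (hφ.isHolMap_transition hφ') := by
  refine Matrix.ext fun a b => HolAlgebra.ev_ext fun u => ?_
  have hu' := mem_transitionDomain.mp u.2
  have hJ : ∀ a, dz φ' (φ.symm u) (coordZ φ a u) = fun i => HolAlgebra.ev u
      (HolAlgebra.jacobian (hφ.isHolMap_transition hφ') i a) := fun a => by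
    rw [hφ.dz_transition hφ', hφ.dz_coordZ hu'.1, Matrix.mulVec_single_one]
    rfl
  refine (g.apply_eq_sum hφ' hu'.2 (hφ.coordZ_mem hu'.1 a) (hφ.coordZ_mem hu'.1 b)).trans ?_
  simp only [Matrix.mul_apply, Matrix.transpose_apply, Matrix.map_apply, map_sum, map_mul, hJ,
    Finset.sum_mul]
  rw [Finset.sum_comm]
  refine Finset.sum_congr rfl fun j _ => Finset.sum_congr rfl fun i _ => ?_
  rw [HolAlgebra.ev_pullback]
  exact congrArg (· * _) (mul_comm _ _)

/-- The curvature tensor does not depend on the para-holomorphic chart. -/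
theorem curvatureIn_eq (hg : g.IsParaHolomorphic) (hφ : J.IsParaHolomorphicChart φ)
    (hφ' : J.IsParaHolomorphicChart φ') {p : M} (hp : p ∈ φ.source) (hp' : p ∈ φ'.source)
    (Z₁ Z₂ Z₃ Z₄ : ParaTangent n M p) :
    g.curvatureIn φ p Z₁ Z₂ Z₃ Z₄ = g.curvatureIn φ' p Z₁ Z₂ Z₃ Z₄ := by
  obtain ⟨u, hu, rfl⟩ : ∃ u ∈ φ.target, φ.symm u = p := ⟨φ p, φ.map_source hp, φ.left_inv hp⟩
  have hu' : u ∈ transitionDomain φ φ' := mem_transitionDomain.mpr ⟨hu, hp'⟩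
  rw [curvatureIn_eq_quadForm, curvatureIn_eq_quadForm,
    hφ.dz_transition hφ' ⟨u, hu'⟩, hφ.dz_transition hφ' ⟨u, hu'⟩, hφ.dz_transition hφ' ⟨u, hu'⟩,
    hφ.dz_transition hφ' ⟨u, hu'⟩, φ.right_inv hu]
  -- Vector components transform by the Jacobian, so it remains to see that the lowered curvature
  -- transforms as a covariant 4-tensor; this is `curv_change` evaluated at `u`.
  refine quadForm_pullback _ (fun a b c d => ?_) _ _ _ _
  have hψ := hφ.isHolMap_transition hφ'
  have h := FormalGeometry.curv_change (D := HolAlgebra.deriv (transitionDomain φ φ'))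
    (D' := HolAlgebra.deriv (chartTarget φ')) (τ := HolAlgebra.pullback hψ)
    (J := HolAlgebra.jacobian hψ) HolAlgebra.deriv_comm
    (HolAlgebra.deriv_jacobian hψ) (hφ.isUnit_det_jacobian hφ') (HolAlgebra.deriv_pullback hψ)
    (holMatrix_isSymm hg hφ (transitionDomain_subset φ φ'))
    (isUnit_det_holMatrix hg hφ (transitionDomain_subset φ φ'))
    (holMatrix_isSymm hg hφ' subset_rfl) (isUnit_det_holMatrix hg hφ' subset_rfl)
    (holMatrix_transition hg hφ hφ') a b
  have h1 := congrArg (fun P => HolAlgebra.ev ⟨u, hu'⟩ (P d c)) h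
  rw [ev_lowered hg hφ (transitionDomain_subset φ φ') ⟨u, hu'⟩]
  refine h1.trans ?_
  have hl : ∀ i j k l, g.lowered φ' (φ' (φ.symm u)) i j k l = HolAlgebra.ev ⟨u, hu'⟩
      (HolAlgebra.pullback hψ ((holMatrix hg hφ' (U := chartTarget φ') subset_rfl *
      FormalGeometry.curv (HolAlgebra.deriv (chartTarget φ'))
        (FormalGeometry.conn (HolAlgebra.deriv (chartTarget φ'))
          (holMatrix hg hφ' (U := chartTarget φ') subset_rfl)) i j) l k)) := fun i j k l =>
    ev_lowered hg hφ' (U := chartTarget φ') subset_rfl ⟨φ' (φ.symm u), hψ.mapsTo hu'⟩ i j k l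
  simp only [hl, Matrix.sum_apply, Matrix.smul_apply, map_sum]
  refine Finset.sum_congr rfl fun i _ => Finset.sum_congr rfl fun j _ => ?_
  rw [Matrix.mul_apply]
  simp only [smul_eq_mul, map_mul, map_sum, Matrix.mul_apply (M := _ᵀ), Matrix.transpose_apply,
    Matrix.map_apply, Finset.mul_sum, Finset.sum_mul]
  refine Finset.sum_congr rfl fun k _ => Finset.sum_congr rfl fun l _ => ?_
  simp only [ParaComplexStructure.IsParaHolomorphicChart.jacobianAt, Matrix.map_apply]
  ring

end ParaComplexMetric
end Manifold

/-! ### Existence of para-holomorphic charts -/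

section Involution

variable {V : Type*} [AddCommGroup V] [Module ℝ V]

theorem sub_mem_eigenspace_of_sq {I : V →ₗ[ℝ] V} (hI : ∀ v, I (I v) = v) (v : V) :
    v - I v ∈ Module.End.eigenspace I (-1 : ℝ) := by
  rw [Module.End.mem_eigenspace_iff, map_sub, hI]; simp

theorem add_mem_eigenspace_of_sq {I : V →ₗ[ℝ] V} (hI : ∀ v, I (I v) = v) (v : V) :
    v + I v ∈ Module.End.eigenspace I (1 : ℝ) := by
  rw [Module.End.mem_eigenspace_iff, map_add, hI, one_smul, add_comm]

theorem eq_zero_of_mem_eigenspaces {I : V →ₗ[ℝ] V} {v : V}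
    (h : v ∈ Module.End.eigenspace I (1 : ℝ)) (h' : v ∈ Module.End.eigenspace I (-1 : ℝ)) :
    v = 0 := by
  rw [Module.End.mem_eigenspace_iff] at h h'
  rw [h, one_smul, neg_one_smul, eq_neg_iff_add_eq_zero, ← two_smul ℝ, smul_eq_zero] at h'
  exact h'.resolve_left (by norm_num)

theorem isCompl_eigenspaces {I : V →ₗ[ℝ] V} (hI : ∀ v, I (I v) = v) :
    IsCompl (Module.End.eigenspace I (1 : ℝ)) (Module.End.eigenspace I (-1 : ℝ)) := by
  refine ⟨Submodule.disjoint_def.mpr fun v => eq_zero_of_mem_eigenspaces, ?_⟩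
  rw [codisjoint_iff, eq_top_iff]
  intro v _
  have hv : v = (2⁻¹ : ℝ) • (v + I v) + (2⁻¹ : ℝ) • (v - I v) := by module
  rw [hv]
  exact Submodule.add_mem_sup (Submodule.smul_mem _ _ (add_mem_eigenspace_of_sq hI v))
    (Submodule.smul_mem _ _ (sub_mem_eigenspace_of_sq hI v))

end Involution

theorem finrank_paraSpace (n : ℕ) : Module.finrank ℝ (ParaSpace n) = n + n := by
  rw [Module.finrank_pi_fintype]
  simp [QuadraticAlgebra.finrank_eq_two, mul_two]

/-- Every `n`-dimensional subspace of `Cⁿ` is the kernel of a map to `ℝⁿ`. -/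
theorem exists_map_to_real {n : ℕ} {F : Submodule ℝ (ParaSpace n)} (hF : Module.finrank ℝ F = n) :
    ∃ A : ParaSpace n →L[ℝ] (Fin n → ℝ), ∀ x, A x = 0 ↔ x ∈ F := by
  have h1 : Module.finrank ℝ (ParaSpace n ⧸ F) = Module.finrank ℝ (Fin n → ℝ) := by
    have := F.finrank_quotient_add_finrank
    rw [hF, finrank_paraSpace] at this
    rw [Module.finrank_fin_fun]
    omega
  let L := LinearEquiv.ofFinrankEq _ _ h1
  refine ⟨LinearMap.toContinuousLinearMap (L.toLinearMap ∘ₗ F.mkQ), fun x => ?_⟩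
  simp

/-- The map `ℝⁿ × ℝⁿ → Cⁿ`, `(x, y) ↦ x (1 + e) + y (1 - e)`. -/
def nullCombine (n : ℕ) : (Fin n → ℝ) × (Fin n → ℝ) →L[ℝ] ParaSpace n :=
  LinearMap.toContinuousLinearMap
    { toFun := fun q i => ⟨q.1 i + q.2 i, q.1 i - q.2 i⟩
      map_add' := fun q r => by funext i; ext <;> simp <;> ring
      map_smul' := fun c q => by funext i; ext <;> simp <;> ring }

theorem nullCombine_apply {n : ℕ} (q : (Fin n → ℝ) × (Fin n → ℝ)) (i : Fin n) :
    nullCombine n q i = ⟨q.1 i + q.2 i, q.1 i - q.2 i⟩ := rfl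

/-- Multiplication by `e` fixes 1 + e and negates 1 - e. -/
theorem nullCombine_neg {n : ℕ} (x y : Fin n → ℝ) :
    nullCombine n (x, -y) = e • nullCombine n (x, y) := by
  funext i
  rw [Pi.smul_apply, nullCombine_apply, nullCombine_apply]
  ext
  · simp [e]; ring
  · simp [e]

theorem nullCombine_eq_zero {n : ℕ} {x y : Fin n → ℝ} (h : nullCombine n (x, y) = 0) :
    x = 0 ∧ y = 0 := by
  have h1 : ∀ i, x i + y i = 0 ∧ x i - y i = 0 := fun i => by
    have := congrFun h i
    rw [nullCombine_apply] at this
    exact ⟨congrArg QuadraticAlgebra.re this, congrArg QuadraticAlgebra.im this⟩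
  exact ⟨funext fun i => by simp only [Pi.zero_apply]; linarith [(h1 i).1, (h1 i).2],
    funext fun i => by simp only [Pi.zero_apply]; linarith [(h1 i).1, (h1 i).2]⟩

section Manifold

variable {n : ℕ} {M : Type*} [TopologicalSpace M] [ChartedSpace (ParaSpace n) M]

/-- The dimension of a subspace is preserved by the differential of a chart. -/
theorem finrank_eq_of_chartDeriv {φ : OpenPartialHomeomorph M (ParaSpace n)}
    (hφ : φ ∈ IsManifold.maximalAtlas 𝓘(ℝ, ParaSpace n) ∞ M) {p : M} (hp : p ∈ φ.source)
    {E : Submodule ℝ (TangentSpace 𝓘(ℝ, ParaSpace n) p)} {F : Submodule ℝ (ParaSpace n)}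
    (h : ∀ v, v ∈ E ↔ chartDeriv φ p v ∈ F) : Module.finrank ℝ F = Module.finrank ℝ E := by
  have hF : F = E.map (chartDeriv φ p).toLinearMap := by
    have hE : E = F.comap (chartDeriv φ p).toLinearMap := Submodule.ext h
    rw [hE]
    exact (Submodule.map_comap_eq_of_surjective
      ((chart_mdifferentiable hφ).mfderiv_surjective hp) F).symm
  rw [hF]
  exact (LinearEquiv.finrank_eq (Submodule.equivMapOfInjective (chartDeriv φ p).toLinearMap
    (chartDeriv_injective hφ hp) E)).symm

/-- A map that is smooth with injective differential on an open set restricts to a diffeomorphism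
near each point of the set. -/
theorem exists_smooth_openPartialHomeomorph {E : Type*} [NormedAddCommGroup E] [NormedSpace ℝ E]
    [FiniteDimensional ℝ E] {f : E → E} {W : Set E} (hW : IsOpen W) (hf : ContDiffOn ℝ ∞ f W)
    (hinj : ∀ u ∈ W, Function.Injective (fderiv ℝ f u)) {u : E} (hu : u ∈ W) :
    ∃ h : OpenPartialHomeomorph E E, u ∈ h.source ∧ h.source ⊆ W ∧ (h : E → E) = f ∧
      ContDiffOn ℝ ∞ h.symm h.target := by
  have : CompleteSpace E := FiniteDimensional.complete ℝ E
  have heq : ∀ u ∈ W, ∃ L : E ≃L[ℝ] E, HasFDerivAt f (L : E →L[ℝ] E) u := fun u hu => by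
    refine ⟨(LinearEquiv.ofInjectiveEndo (fderiv ℝ f u).toLinearMap
      (hinj u hu)).toContinuousLinearEquiv, ?_⟩
    have hd := ((hf.contDiffAt (hW.mem_nhds hu)).differentiableAt (by simp)).hasFDerivAt
    convert hd using 1
    ext x
    rfl
  obtain ⟨L, hL⟩ := heq u hu
  have hfu := hf.contDiffAt (hW.mem_nhds hu)
  let h₀ := hfu.toOpenPartialHomeomorph f hL (by simp)
  have h₀f : (h₀ : E → E) = f := hfu.toOpenPartialHomeomorph_coe hL (by simp)
  -- Restricting the source to `W` keeps the differential invertible at every point, which is what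
  -- makes the inverse smooth on the whole target.
  refine ⟨h₀.restrOpen W hW, ?_, ?_, h₀f, fun y hy => ?_⟩
  · exact ⟨hfu.mem_toOpenPartialHomeomorph_source hL (by simp), hu⟩
  · exact fun x hx => hx.2
  · have hx := ((h₀.restrOpen W hW).map_target hy).2
    obtain ⟨L', hL'⟩ := heq _ hx
    refine ContDiffAt.contDiffWithinAt ?_
    refine (h₀.restrOpen W hW).contDiffAt_symm (f₀' := L') hy ?_ ?_
    · exact h₀f.symm ▸ hL'
    · exact h₀f.symm ▸ hf.contDiffAt (hW.mem_nhds hx)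

variable [IsManifold 𝓘(ℝ, ParaSpace n) ∞ M]

/-- A para-complex manifold has para-holomorphic charts around each point. -/
theorem ParaComplexStructure.exists_isParaHolomorphicChart (J : ParaComplexStructure n M) (p : M) :
    ∃ χ : OpenPartialHomeomorph M (ParaSpace n), J.IsParaHolomorphicChart χ ∧ p ∈ χ.source := by
  obtain ⟨φ, hφ, hp, F, hF⟩ := J.integrable_pos p
  obtain ⟨ψ, hψ, hp', F', hF'⟩ := J.integrable_neg p
  have hsq : ∀ (q : M) v, (J.I q).toLinearMap ((J.I q).toLinearMap v) = v := J.sq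
  have hdim : Module.finrank ℝ (Module.End.eigenspace (J.I p).toLinearMap (1 : ℝ)) = n ∧
      Module.finrank ℝ (Module.End.eigenspace (J.I p).toLinearMap (-1 : ℝ)) = n := by
    have : FiniteDimensional ℝ (TangentSpace 𝓘(ℝ, ParaSpace n) p) :=
      inferInstanceAs (FiniteDimensional ℝ (ParaSpace n))
    have h1 := Submodule.finrank_add_eq_of_isCompl (isCompl_eigenspaces (hsq p))
    have h2 : Module.finrank ℝ (TangentSpace 𝓘(ℝ, ParaSpace n) p) = n + n := finrank_paraSpace n
    have h3 := J.finrank_eq p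
    omega
  obtain ⟨B, hB⟩ := exists_map_to_real
    ((finrank_eq_of_chartDeriv hφ hp (hF p hp)).trans hdim.1)
  obtain ⟨A, hA⟩ := exists_map_to_real
    ((finrank_eq_of_chartDeriv hψ hp' (hF' p hp')).trans hdim.2)
  -- In the coordinates of `φ`: the functions `B ∘ φ` are killed by the +1 eigenspaces, and `A ∘ ψ`
  -- by the -1 eigenspaces. So d(A ∘ ψ) absorbs `I` with sign + and pairs with 1 + e, while d(B ∘ φ)
  -- takes sign - and pairs with 1 - e.
  let f : ParaSpace n → ParaSpace n := fun u => nullCombine n (A ((ψ ∘ φ.symm) u), B u)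
  let W : TopologicalSpace.Opens (ParaSpace n) := transitionDomain φ ψ
  have hτ : ContDiffOn ℝ ∞ (ψ ∘ φ.symm) W :=
    ((contMDiffOn_of_mem_maximalAtlas hψ).comp ((contMDiffOn_symm_of_mem_maximalAtlas hφ).mono
      (transitionDomain_subset φ ψ)) fun u hu => (mem_transitionDomain.mp hu).2).contDiffOn
  have hf : ContDiffOn ℝ ∞ f W := (nullCombine n).contDiff.comp_contDiffOn
    ((A.contDiff.comp_contDiffOn hτ).prodMk B.contDiff.contDiffOn)
  have hfd : ∀ u ∈ W, ∀ v : TangentSpace 𝓘(ℝ, ParaSpace n) (φ.symm u),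
      fderiv ℝ f u (chartDeriv φ (φ.symm u) v) =
        nullCombine n (A (chartDeriv ψ (φ.symm u) v), B (chartDeriv φ (φ.symm u) v)) := by
    intro u hu v
    have hu' := mem_transitionDomain.mp hu
    have hd := ((hτ.contDiffAt (W.isOpen.mem_nhds hu)).differentiableAt (by simp)).hasFDerivAt
    have h1 : HasFDerivAt f _ u := (nullCombine n).hasFDerivAt.comp u
      ((A.hasFDerivAt.comp u hd).prodMk B.hasFDerivAt)
    have h2 : coordVector φ (chartDeriv φ (φ.symm u) v) u = v :=
      chartDeriv_injective hφ (φ.map_target hu'.1) (chartDeriv_coordVector hφ hu'.1 _)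
    rw [h1.fderiv]
    change nullCombine n (A (fderiv ℝ (ψ ∘ φ.symm) u (chartDeriv φ (φ.symm u) v)),
      B (chartDeriv φ (φ.symm u) v)) = _
    rw [fderiv_transition hφ hψ hu, h2]
  have hinj : ∀ u ∈ W, Function.Injective (fderiv ℝ f u) := by
    intro u hu
    have hu' := mem_transitionDomain.mp hu
    rw [injective_iff_map_eq_zero]
    intro w hw
    obtain ⟨v, rfl⟩ := (chart_mdifferentiable hφ).mfderiv_surjective (φ.map_target hu'.1) w
    have h1 := nullCombine_eq_zero ((hfd u hu v).symm.trans hw)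
    -- The kernel of the differential lies in both eigenspaces, which meet only in zero.
    have hv : v = 0 := eq_zero_of_mem_eigenspaces
      ((hF _ (φ.map_target hu'.1) v).mpr ((hB _).mp h1.2)) ((hF' _ hu'.2 v).mpr ((hA _).mp h1.1))
    subst hv
    exact map_zero (chartDeriv φ _)
  have hpW : φ p ∈ W := mem_transitionDomain.mpr
    ⟨φ.map_source hp, by rw [φ.left_inv hp]; exact hp'⟩
  obtain ⟨h, hph, hhW, rfl', hsymm⟩ := exists_smooth_openPartialHomeomorph W.isOpen hf hinj hpW
  have hsm : ContDiffOn ℝ ∞ h h.source := rfl' ▸ hf.mono hhW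
  refine ⟨φ.trans h, ⟨?_, ?_⟩, ?_⟩
  · refine OpenPartialHomeomorph.mem_maximalAtlas_of_contMDiffOn _ ?_ ?_
    · exact hsm.contMDiffOn.comp ((contMDiffOn_of_mem_maximalAtlas hφ).mono fun q hq => hq.1)
        fun q hq => hq.2
    · exact (contMDiffOn_symm_of_mem_maximalAtlas hφ).comp
        (hsymm.contMDiffOn.mono fun q hq => hq.1) fun q hq => hq.2
  · intro q hq v
    have hq1 : q ∈ φ.source := hq.1
    have hq2 : φ q ∈ W := hhW hq.2
    have hcomp : ∀ v, chartDeriv (φ.trans h) q v = fderiv ℝ f (φ q) (chartDeriv φ q v) := by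
      intro v
      have hd := ((hf.contDiffAt (W.isOpen.mem_nhds hq2)).differentiableAt (by simp))
      have h1 := mfderiv_comp q hd.mdifferentiableAt
        ((chart_mdifferentiable hφ).mdifferentiableAt hq1)
      rw [mfderiv_eq_fderiv] at h1
      have h2 : ((φ.trans h : OpenPartialHomeomorph M (ParaSpace n)) : M → ParaSpace n) = f ∘ φ := by
        rw [OpenPartialHomeomorph.coe_trans, rfl']
      rw [chartDeriv, h2, h1]
      rfl
    rw [hcomp, hcomp]
    obtain ⟨u, hu, rfl⟩ : ∃ u ∈ φ.target, φ.symm u = q := ⟨φ q, φ.map_source hq1, φ.left_inv hq1⟩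
    rw [φ.right_inv hu] at hq2 ⊢
    have hq3 := (mem_transitionDomain.mp hq2).2
    rw [hfd u hq2, hfd u hq2, ← nullCombine_neg]
    -- Here v - I v lies in the -1 eigenspace, the kernel of dA; below, v + I v lies in the +1
    -- eigenspace, the kernel of dB.
    have hA' : A (chartDeriv ψ (φ.symm u) (J.I _ v)) = A (chartDeriv ψ (φ.symm u) v) := by
      rw [eq_comm, ← sub_eq_zero, ← map_sub, ← map_sub, hA]
      exact (hF' _ hq3 _).mp (sub_mem_eigenspace_of_sq (hsq _) v)
    have hB' : B (chartDeriv φ (φ.symm u) (J.I _ v)) = -B (chartDeriv φ (φ.symm u) v) := by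
      rw [eq_neg_iff_add_eq_zero, add_comm, ← map_add, ← map_add, hB]
      exact (hF _ hq1 _).mp (add_mem_eigenspace_of_sq (hsq _) v)
    rw [hA', hB']
  · exact ⟨hp, hph⟩

end Manifold

/-! ### Schur's lemma on the manifold -/

theorem quadForm_unitCurvature {n : ℕ} {A : Type*} [CommRing A] (G : Matrix (Fin n) (Fin n) A)
    (x y z w : Fin n → A) : quadForm (unitCurvature G) x y z w =
      (∑ a, ∑ c, G a c * x a * z c) * (∑ b, ∑ d, G b d * y b * w d) -
        (∑ a, ∑ d, G a d * x a * w d) * (∑ b, ∑ c, G b c * y b * z c) := by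
  simp only [Finset.sum_mul_sum, ← Finset.sum_sub_distrib, quadForm, unitCurvature]
  refine Finset.sum_congr rfl fun a _ => Finset.sum_congr rfl fun b _ => ?_
  have h : ∑ d, ∑ c, G a d * x a * w d * (G b c * y b * z c) =
      ∑ c, ∑ d, G a d * x a * w d * (G b c * y b * z c) := Finset.sum_comm
  simp only [Finset.sum_sub_distrib, h]
  simp only [← Finset.sum_sub_distrib]
  exact Finset.sum_congr rfl fun c _ => Finset.sum_congr rfl fun d _ => by ring

theorem IsCurvatureLike.map {n : ℕ} {A B : Type*} [CommRing A] [CommRing B] (f : A →+* B)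
    {S : Fin n → Fin n → Fin n → Fin n → A} (hS : IsCurvatureLike S) :
    IsCurvatureLike fun a b c d => f (S a b c d) where
  skew_left a b c d := by rw [hS.skew_left, map_neg]
  skew_right a b c d := by rw [hS.skew_right, map_neg]
  bianchi a b c d := by rw [← map_add, ← map_add, hS.bianchi, map_zero]

namespace FormalGeometry

theorem mul_model_apply {A : Type*} [CommRing A] {n : ℕ} {G : Matrix (Fin n) (Fin n) A}
    (hG : G.IsSymm) (a b c d : Fin n) :
    (G * model G a b) d c = unitCurvature G a b c d := by
  have h1 : ∀ (q : A) (b : Fin n), ∑ f, G d f * (q * (1 : Matrix (Fin n) (Fin n) A) f b) =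
      q * G d b := fun q b => by simp [Matrix.one_apply, mul_comm]
  simp only [Matrix.mul_apply, model, Matrix.of_apply, mul_sub, Finset.sum_sub_distrib, h1,
    unitCurvature, hG.apply d]

variable {A : Type*} [CommRing A] [Algebra ℝ A] {n : ℕ} {D : Fin n → Derivation ℝ A A}
  {G : Matrix (Fin n) (Fin n) A}

theorem conn_symm (hG : G.IsSymm) (a b c : Fin n) : conn D G a c b = conn D G b c a :=
  christoffel_symm hG c b a

/-- The lowered curvature of the Levi-Civita connection has the symmetries of a curvature tensor. -/
theorem isCurvatureLike_curv (hD : ∀ a b x, D a (D b x) = D b (D a x)) (hG : G.IsSymm)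
    (hdet : IsUnit G.det) : IsCurvatureLike fun a b c d => (G * curv D (conn D G) a b) d c := by
  refine ⟨fun a b c d => ?_, fun a b c d => ?_, fun a b c d => ?_⟩
  · rw [curv_antisymm, mul_neg, Matrix.neg_apply]
  · have h := curv_skew hD (conn_metric hG hdet) a b
    have hT : (curv D (conn D G) a b)ᵀ * G = (G * curv D (conn D G) a b)ᵀ := by
      rw [Matrix.transpose_mul, hG.eq]
    rw [hT] at h
    exact eq_neg_of_add_eq_zero_left (congrFun (congrFun h c) d)
  · rw [Matrix.mul_apply, Matrix.mul_apply, Matrix.mul_apply,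
      ← Finset.sum_add_distrib, ← Finset.sum_add_distrib]
    refine Finset.sum_eq_zero fun f _ => ?_
    rw [← mul_add, ← mul_add, bianchi_first (conn_symm hG), mul_zero]

/-- Schur's lemma for a ring of functions: if the curvature is pointwise a multiple of the constant
curvature one tensor, then the factor is an element of the ring with vanishing derivatives. -/
theorem exists_constant_factor {X B : Type*} [CommRing B] (ev : X → A →+* B)
    (hev : ∀ f g, (∀ x, ev x f = ev x g) → f = g) (hn : 3 ≤ n)
    (hD : ∀ a b x, D a (D b x) = D b (D a x)) (hG : G.IsSymm) (hdet : IsUnit G.det) {k : X → B}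
    (hk : ∀ x a b c d, ev x ((G * curv D (conn D G) a b) d c) =
      k x * ev x (unitCurvature G a b c d)) :
    ∃ κ : A, (∀ a, D a κ = 0) ∧ ∀ x, ev x κ = k x := by
  let i : Fin n := ⟨0, by omega⟩
  let j : Fin n := ⟨1, by omega⟩
  have hij : j ≠ i := by simp [i, j]
  have hpt : ∀ x a b f c, ev x (curv D (conn D G) a b f c) = k x * ev x (model G a b f c) := by
    intro x a b f c
    have h2 : ∀ P : Matrix (Fin n) (Fin n) A, P f c = ∑ d, G⁻¹ f d * (G * P) d c := fun P => by
      rw [← Matrix.mul_apply, ← mul_assoc, Matrix.nonsing_inv_mul _ hdet, one_mul]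
    rw [h2 (curv D (conn D G) a b), h2 (model G a b), map_sum, map_sum, Finset.mul_sum]
    refine Finset.sum_congr rfl fun d _ => ?_
    rw [map_mul, map_mul, hk, mul_model_apply hG]
    ring
  -- A priori `k` is a bare function of the point. For j ≠ i the row (T_ij)ʲ_c is G_ic, so
  -- contracting the same row of the curvature with G⁻¹_ci recovers `k` as an element of the
  -- algebra.
  have hκ : ∀ x, ev x (∑ c, curv D (conn D G) i j j c * G⁻¹ c i) = k x := by
    intro x
    have h1 : ∀ c, model G i j j c = G i c := fun c => by simp [model, Matrix.one_apply, hij]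
    have h2 : ∑ c, G i c * G⁻¹ c i = 1 := by
      rw [← Matrix.mul_apply, Matrix.mul_nonsing_inv _ hdet, Matrix.one_apply_eq]
    simp only [map_sum, map_mul, hpt, h1, mul_assoc]
    rw [← Finset.mul_sum]
    simp only [← map_mul]
    rw [← map_sum, h2, map_one, mul_one]
  refine ⟨_, fun e => ?_, hκ⟩
  refine schur hn hD hdet (conn_symm hG) (conn_metric hG hdet)
    (fun a b => ?_) e
  refine Matrix.ext fun f c => hev _ _ fun x => ?_
  rw [Matrix.smul_apply, smul_eq_mul, map_mul, hκ, hpt]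

end FormalGeometry

section Manifold

variable {n : ℕ} {M : Type*} [TopologicalSpace M] [ChartedSpace (ParaSpace n) M]
variable [IsManifold 𝓘(ℝ, ParaSpace n) ∞ M] {J : ParaComplexStructure n M}
  {φ : OpenPartialHomeomorph M (ParaSpace n)}

namespace ParaComplexMetric

variable {g : ParaComplexMetric J} (hg : g.IsParaHolomorphic) (hφ : J.IsParaHolomorphicChart φ)

theorem isCurvatureLike_lowered (hg : g.IsParaHolomorphic) (hφ : J.IsParaHolomorphicChart φ)
    {u : ParaSpace n} (hu : u ∈ φ.target) : IsCurvatureLike (g.lowered φ u) := by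
  have h := (FormalGeometry.isCurvatureLike_curv (D := HolAlgebra.deriv (chartTarget φ))
    HolAlgebra.deriv_comm (holMatrix_isSymm hg hφ subset_rfl) (isUnit_det_holMatrix hg hφ (U := chartTarget φ)
      subset_rfl)).map (HolAlgebra.ev ⟨u, hu⟩)
  have h2 : g.lowered φ u = _ := funext fun a => funext fun b => funext fun c => funext fun d =>
    ev_lowered hg hφ (U := chartTarget φ) subset_rfl ⟨u, hu⟩ a b c d
  rw [h2]
  exact h

theorem gram_eq_quadForm (hφ : J.IsParaHolomorphicChart φ) {p : M} (hp : p ∈ φ.source)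
    {Z W : ParaTangent n M p} (hZ : Z ∈ J.T10 p) (hW : W ∈ J.T10 p) :
    g.gram p Z W = quadForm (unitCurvature (g.comp φ (φ p))) (dz φ p Z) (dz φ p W) (dz φ p Z)
      (dz φ p W) := by
  rw [quadForm_unitCurvature, ← g.apply_eq_sum hφ hp hZ hZ, ← g.apply_eq_sum hφ hp hW hW,
    ← g.apply_eq_sum hφ hp hZ hW, ← g.apply_eq_sum hφ hp hW hZ, gram, g.symm p W Z, sq]

/-- Chart independence replaces the chart selected by choice in the definition with any given one.
-/
theorem curvature_eq (hg : g.IsParaHolomorphic) (hφ : J.IsParaHolomorphicChart φ) {p : M}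
    (hp : p ∈ φ.source) (Z₁ Z₂ Z₃ Z₄ : ParaTangent n M p) :
    g.curvature p Z₁ Z₂ Z₃ Z₄ = g.curvatureIn φ p Z₁ Z₂ Z₃ Z₄ := by
  have h : ∃ φ : OpenPartialHomeomorph M (ParaSpace n),
      J.IsParaHolomorphicChart φ ∧ p ∈ φ.source := ⟨φ, hφ, hp⟩
  rw [curvature, dif_pos h]
  exact curvatureIn_eq hg h.choose_spec.1 hφ h.choose_spec.2 hp _ _ _ _

/-- At a point of constant sectional curvature `k` the curvature tensor is `k` times the curvature
tensor of constant curvature one. -/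
theorem lowered_eq (hn : 2 ≤ n) (hg : g.IsParaHolomorphic) (hφ : J.IsParaHolomorphicChart φ)
    {u : ParaSpace n} (hu : u ∈ φ.target) {k : ParaComplex}
    (hk : ∀ Z₁ Z₂ : ParaTangent n M (φ.symm u),
      g.SpansParaHolomorphicPlane (φ.symm u) Z₁ Z₂ →
        g.sectionalCurvature (φ.symm u) Z₁ Z₂ = k) (a b c d : Fin n) :
    g.lowered φ u a b c d = k * unitCurvature (g.comp φ u) a b c d := by
  have hp := φ.map_target hu
  refine ParaComplex.eq_unitCurvature hn (isCurvatureLike_lowered hg hφ hu) (g.comp_isSymm φ u)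
    (g.isUnit_det_comp hφ hu) (fun z w hzw => ?_) a b c d
  obtain ⟨Z, hZ, rfl⟩ := hφ.exists_dz_eq hp z
  obtain ⟨W, hW, rfl⟩ := hφ.exists_dz_eq hp w
  have hgram := gram_eq_quadForm (g := g) hφ hp hZ hW
  rw [φ.right_inv hu] at hgram
  rw [← hgram] at hzw ⊢
  -- The Gram determinant is a unit, so `Ring.inverse` is a genuine inverse and multiplying back
  -- leaves the curvature itself.
  rw [← hk Z W ⟨hZ, hW, hzw⟩, sectionalCurvature, mul_assoc, Ring.inverse_mul_cancel _ hzw, mul_one,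
    curvature_eq hg hφ hp, curvatureIn_eq_quadForm, φ.right_inv hu]

/-- In a para-holomorphic chart, pointwise constant sectional curvature is given by a
para-holomorphic function with vanishing derivatives. -/
theorem exists_curvature_function (hn : 3 ≤ n) (hg : g.IsParaHolomorphic)
    (hφ : J.IsParaHolomorphicChart φ) {k : M → ParaComplex}
    (hk : ∀ p, ∀ Z₁ Z₂ : ParaTangent n M p,
      g.SpansParaHolomorphicPlane p Z₁ Z₂ → g.sectionalCurvature p Z₁ Z₂ = k p) :
    ∃ κ : HolAlgebra (chartTarget φ), (∀ a, HolAlgebra.deriv _ a κ = 0) ∧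
      ∀ u : chartTarget φ, HolAlgebra.ev u κ = k (φ.symm u) := by
  refine FormalGeometry.exists_constant_factor
    (D := HolAlgebra.deriv (chartTarget φ)) HolAlgebra.ev (fun _ _ => HolAlgebra.ev_ext) hn
    HolAlgebra.deriv_comm (holMatrix_isSymm hg hφ subset_rfl)
    (isUnit_det_holMatrix hg hφ subset_rfl) (k := fun u : chartTarget φ => k (φ.symm u))
    fun u a b c d => ?_
  refine (ev_lowered hg hφ subset_rfl u a b c d).symm.trans
    ((lowered_eq (by omega) hg hφ u.2 (hk (φ.symm u)) a b c d).trans ?_)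
  simp only [unitCurvature, map_sub, map_mul]
  rfl

/-- The target of a chart need not be connected, so vanishing of the differential is integrated over
a ball inside it. -/
theorem isLocallyConstant_curvature (hn : 3 ≤ n) (hg : g.IsParaHolomorphic) {k : M → ParaComplex}
    (hk : ∀ p, ∀ Z₁ Z₂ : ParaTangent n M p,
      g.SpansParaHolomorphicPlane p Z₁ Z₂ → g.sectionalCurvature p Z₁ Z₂ = k p) :
    IsLocallyConstant k := by
  refine IsLocallyConstant.iff_eventually_eq k |>.mpr fun p => ?_
  obtain ⟨φ, hφ, hp⟩ := J.exists_isParaHolomorphicChart p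
  obtain ⟨κ, hκ, hev⟩ := exists_curvature_function hn hg hφ hk
  have hrep : ∀ q ∈ φ.source, HolAlgebra.rep κ (φ q) = k q := fun q hq => by
    have := hev ⟨φ q, φ.map_source hq⟩
    rw [φ.left_inv hq] at this
    exact (HolAlgebra.rep_apply κ ⟨φ q, φ.map_source hq⟩).trans this
  obtain ⟨r, hr, hball⟩ := Metric.isOpen_iff.mp φ.open_target _ (φ.map_source hp)
  have hconst : ∀ v ∈ Metric.ball (φ p) r, HolAlgebra.rep κ v = HolAlgebra.rep κ (φ p) := by
    intro v hv
    refine Metric.isOpen_ball.is_const_of_fderiv_eq_zero (𝕜 := ℝ)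
      (convex_ball (φ p) r).isPreconnected (fun x hx => ?_) (fun x hx => ?_) hv
      (Metric.mem_ball_self hr)
    · exact ((HolAlgebra.isParaHolomorphicOn_rep κ).differentiableAt φ.open_target
        (hball hx)).differentiableWithinAt
    · exact HolAlgebra.fderiv_eq_zero_of_deriv (HolAlgebra.rep_apply κ) hκ ⟨x, hball hx⟩
  filter_upwards [φ.open_source.mem_nhds hp,
    (φ.continuousAt hp).preimage_mem_nhds (Metric.ball_mem_nhds _ hr)] with q hq hqr
  rw [← hrep q hq, ← hrep p hp, hconst _ hqr]

end ParaComplexMetric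
end Manifold

end

theorem mainTheorem8 (n : ℕ) (hn : 3 ≤ n) (M : Type*) [TopologicalSpace M] [ConnectedSpace M]
    [ChartedSpace (ParaSpace n) M] [IsManifold 𝓘(ℝ, ParaSpace n) ∞ M]
    (J : ParaComplexStructure n M) (g : ParaComplexMetric J) (hg : g.IsParaHolomorphic)
    (hK : ∀ p : M, ∃ k : ParaComplex, ∀ Z₁ Z₂ : ParaTangent n M p,
      g.SpansParaHolomorphicPlane p Z₁ Z₂ → g.sectionalCurvature p Z₁ Z₂ = k) :
    ∃ c : ParaComplex, ∀ (p : M) (Z₁ Z₂ : ParaTangent n M p),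
      g.SpansParaHolomorphicPlane p Z₁ Z₂ → g.sectionalCurvature p Z₁ Z₂ = c := by
  -- The constants are chosen point by point with no regularity. They are nevertheless determined by
  -- the curvature, because nondegenerate planes exist at every point; this is implicit in the
  -- contraction formula for `k`.
  choose k hk using hK
  obtain ⟨c, hc⟩ := (ParaComplexMetric.isLocallyConstant_curvature hn hg hk).exists_eq_const
  exact ⟨c, fun p Z₁ Z₂ h => (hk p Z₁ Z₂ h).trans (congrFun hc p)⟩
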